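/- Let $k$ be a field. A coquasitriangular Hopf algebra $(H,\mathcal R)$ is a Hopf algebra $H$ over $k$ with a convolution-invertible linear form $\mathcal R: H\otimes H\to k$ such that, in Sweedler notation, $$\mathcal R(ab,c)=\mathcal R(a,c_1)\mathcal R(b,c_2),\qquad \mathcal R(a,bc)=\mathcal R(a_1,c)\mathcal R(a_2,b),\qquad b_1a_1\,\mathcal R(a_2,b_2)=\mathcal R(a_1,b_1)\,a_2b_2$$ for all $a,b,c\in H$. A coalgebra is pointed if all its simple subcoalgebras are one-dimensional (equivalently, all its simple comodules are one-dimensional). Its coradical filtration is given by $H_0=$ the sum of all simple subcoalgebras, and $H_{n+1}=\Delta^{-1}(H\otimes H_n+H_0\otimes H)$; put $H_{-1}=0$. Let $(H,\mathcal R)$ be a coquasitriangular Hopf algebra over $k$ that is pointed (of arbitrary dimension). Then $\{H_n\}_{n\ge 0}$ is a Hopf algebra filtration, so that $$\operatorname{gr}(H)=H_0\oplus H_1/H_0\oplus H_2/H_1\oplus\cdots$$ is a Hopf algebra with the structure induced from $H$. Define the linear form $\operatorname{gr}(\mathcal R)$ on $\operatorname{gr}(H)\otimes\operatorname{gr}(H)$,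 for homogeneous $g,h$, by $\operatorname{gr}(\mathcal R)(g,h)=\mathcal R(g,h)$ if $g,h\in H_0$, and $\operatorname{gr}(\mathcal R)(g,h)=0$ if $g$ or $h$ has positive degree. Then $(\operatorname{gr}(H),\operatorname{gr}(\mathcal R))$ is again a coquasitriangular pointed Hopf algebra. -/

import Mathlib

open scoped TensorProduct DirectSum

universe u v

noncomputable section

namespace CoquasiDegeneration

open Coalgebra

section CoalgebraNotions

variable (k : Type u) {C : Type v} [Field k] [AddCommGroup C] [Module k C] [Coalgebra k C]

/-- A subspace `D` is a subcoalgebra if `Δ(D) ⊆ D ⊗ D`. -/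
def IsSubcoalgebra (D : Submodule k C) : Prop :=
  ∀ x ∈ D, comul (R := k) x ∈ LinearMap.range (TensorProduct.map D.subtype D.subtype)

/-- A simple subcoalgebra: nonzero, with no subcoalgebras other than zero and itself. -/
def IsSimpleSubcoalgebra (D : Submodule k C) : Prop :=
  IsSubcoalgebra k D ∧ D ≠ ⊥ ∧
    ∀ E : Submodule k C, IsSubcoalgebra k E → E ≤ D → E = ⊥ ∨ E = D

variable (C)

/-- A coalgebra is pointed if all its simple subcoalgebras are one-dimensional. -/
def IsPointed : Prop :=
  ∀ D : Submodule k C, IsSimpleSubcoalgebra k D → Module.finrank k D = 1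

/-- The coradical: the sum of all simple subcoalgebras. -/
def coradical : Submodule k C :=
  sSup {D : Submodule k C | IsSimpleSubcoalgebra k D}

/-- The coradical filtration: `C₀` is the coradical and
`Cₙ₊₁ = Δ⁻¹(C ⊗ Cₙ + C₀ ⊗ C)`. -/
def coradicalFiltration : ℕ → Submodule k C
  | 0 => coradical k C
  | n + 1 =>
      (LinearMap.range (LinearMap.lTensor C (coradicalFiltration n).subtype) ⊔
        LinearMap.range (LinearMap.rTensor C (coradical k C).subtype)).comap
        (comul (R := k) (A := C))

/-- The term `Cₙ₋₁` of the coradical filtration, with `C₋₁ = 0`. -/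
def coradicalFiltrationPred : ℕ → Submodule k C
  | 0 => ⊥
  | n + 1 => coradicalFiltration k C n

/-- The homogeneous component `Cₙ / Cₙ₋₁` of degree `n`. -/
abbrev GrPiece (n : ℕ) : Type v :=
  coradicalFiltration k C n ⧸
    (coradicalFiltrationPred k C n).comap (coradicalFiltration k C n).subtype

/-- The underlying vector space `C₀ ⊕ C₁/C₀ ⊕ C₂/C₁ ⊕ ⋯` of `gr(C)`. -/
abbrev Gr : Type v := ⨁ n : ℕ, GrPiece k C n

/-- The map `Cₙ → gr(C)` that sends `x` to its class in degree `n`. -/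
def grClass (n : ℕ) : coradicalFiltration k C n →ₗ[k] Gr k C :=
  DirectSum.lof k ℕ (GrPiece k C) n ∘ₗ
    ((coradicalFiltrationPred k C n).comap (coradicalFiltration k C n).subtype).mkQ

/-- The projection of `gr(C)` onto its component `C₀/0 = C₀` of degree zero, viewed in `C`. -/
def grDegreeZero : Gr k C →ₗ[k] C :=
  ((coradicalFiltrationPred k C 0).comap (coradicalFiltration k C 0).subtype).liftQ
      (coradicalFiltration k C 0).subtype (fun _ hx => hx) ∘ₗ
    DirectSum.component k ℕ (GrPiece k C) 0

variable {k C}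

/-- For a bilinear form `𝓡` on `C`, the bilinear form `gr(𝓡)` on `gr(C)`: it is `𝓡` on the
component `C₀` of degree zero, and it vanishes if one of the two homogeneous arguments
has positive degree. -/
def grForm (R : C ⊗[k] C →ₗ[k] k) : Gr k C ⊗[k] Gr k C →ₗ[k] k :=
  R ∘ₗ TensorProduct.map (grDegreeZero k C) (grDegreeZero k C)

end CoalgebraNotions

section HopfNotions

variable (k : Type u) (H : Type v) [Field k] [Ring H] [HopfAlgebra k H]

/-- `(H, 𝓡)` is a coquasitriangular Hopf algebra. In Sweedler notation the axioms are
`𝓡(ab, c) = 𝓡(a, c₁) 𝓡(b, c₂)`, `𝓡(a, bc) = 𝓡(a₁, c) 𝓡(a₂, b)` and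
`b₁a₁ 𝓡(a₂, b₂) = 𝓡(a₁, b₁) a₂b₂`. The last one is written as an identity in the convolution
algebra of linear maps `H ⊗ H → H`. -/
structure IsCoquasitriangular (R : H ⊗[k] H →ₗ[k] k) : Prop where
  convolution_invertible : IsUnit (WithConv.toConv R)
  mul_left : ∀ a b c : H, R ((a * b) ⊗ₜ[k] c) =
    LinearMap.mul' k k
      (TensorProduct.map (TensorProduct.curry R a) (TensorProduct.curry R b) (comul c))
  mul_right : ∀ a b c : H, R (a ⊗ₜ[k] (b * c)) =
    LinearMap.mul' k k
      (TensorProduct.map ((TensorProduct.curry R).flip c) ((TensorProduct.curry R).flip b)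
        (comul a))
  comm : WithConv.toConv (LinearMap.mul' k H ∘ₗ (TensorProduct.comm k H H).toLinearMap) *
      WithConv.toConv (Algebra.linearMap k H ∘ₗ R) =
    WithConv.toConv (Algebra.linearMap k H ∘ₗ R) * WithConv.toConv (LinearMap.mul' k H)

/-- The degeneration of `H`: the space `gr(H) = H₀ ⊕ H₁/H₀ ⊕ H₂/H₁ ⊕ ⋯` with the Hopf algebra
structure inherited from `H`. The Hopf algebra `carrier` is a copy of the space `gr(H)` through
`equiv`, and every structure map is prescribed on the classes `[x]ₙ` of elements `x ∈ Hₙ`, which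
span `gr(H)`; so the structure is unique if it exists. It exists only if the coradical filtration
is a Hopf algebra filtration, which is part of the conditions below. -/
structure Degeneration where
  carrier : Type v
  [ring : Ring carrier]
  [hopf : HopfAlgebra k carrier]
  equiv : Gr k H ≃ₗ[k] carrier
  /-- `1 ∈ H₀`, and the unit is `[1]₀`. -/
  one_eq : ∃ h : (1 : H) ∈ coradicalFiltration k H 0, equiv (grClass k H 0 ⟨1, h⟩) = 1
  /-- `Hₘ Hₙ ⊆ Hₘ₊ₙ`, and `[x]ₘ [y]ₙ = [xy]ₘ₊ₙ`. -/
  mul_eq : ∀ (m n : ℕ) (x : coradicalFiltration k H m) (y : coradicalFiltration k H n),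
    ∃ h : (x : H) * (y : H) ∈ coradicalFiltration k H (m + n),
      equiv (grClass k H m x) * equiv (grClass k H n y) =
        equiv (grClass k H (m + n) ⟨(x : H) * (y : H), h⟩)
  /-- The counit is that of `H` in degree zero, and zero in positive degrees. -/
  counit_eq : ∀ (n : ℕ) (x : coradicalFiltration k H n),
    counit (R := k) (equiv (grClass k H n x)) = if n = 0 then counit (R := k) (x : H) else 0
  /-- `Δ(x) = ∑ wᵢⱼ` with `wᵢⱼ ∈ Hᵢ ⊗ Hⱼ`, `i + j = n`, for `x ∈ Hₙ`, and `Δ([x]ₙ)` is the sum of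
  the classes of the `wᵢⱼ` in `Hᵢ/Hᵢ₋₁ ⊗ Hⱼ/Hⱼ₋₁`. -/
  comul_eq : ∀ (n : ℕ) (x : coradicalFiltration k H n),
    ∃ w : ∀ i j : ℕ, coradicalFiltration k H i ⊗[k] coradicalFiltration k H j,
      comul (R := k) (x : H) = ∑ p ∈ Finset.HasAntidiagonal.antidiagonal n,
        TensorProduct.map (coradicalFiltration k H p.1).subtype
          (coradicalFiltration k H p.2).subtype (w p.1 p.2) ∧
      comul (R := k) (equiv (grClass k H n x)) = ∑ p ∈ Finset.HasAntidiagonal.antidiagonal n,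
        TensorProduct.map (equiv.toLinearMap ∘ₗ grClass k H p.1)
          (equiv.toLinearMap ∘ₗ grClass k H p.2) (w p.1 p.2)
  /-- `S(Hₙ) ⊆ Hₙ`, and `S([x]ₙ) = [S(x)]ₙ`. -/
  antipode_eq : ∀ (n : ℕ) (x : coradicalFiltration k H n),
    ∃ h : HopfAlgebra.antipode k (x : H) ∈ coradicalFiltration k H n,
      HopfAlgebra.antipode k (equiv (grClass k H n x)) =
        equiv (grClass k H n ⟨HopfAlgebra.antipode k (x : H), h⟩)

attribute [instance] Degeneration.ring Degeneration.hopf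

variable {k H}

/-- The form `gr(𝓡)` on the degeneration of `H`. -/
def Degeneration.form (D : Degeneration k H) (R : H ⊗[k] H →ₗ[k] k) :
    D.carrier ⊗[k] D.carrier →ₗ[k] k :=
  grForm R ∘ₗ TensorProduct.map D.equiv.symm.toLinearMap D.equiv.symm.toLinearMap

end HopfNotions

end CoquasiDegeneration

end

/-! Work in the dual algebra of `C` under convolution. Let `Jₙ` be the annihilator of `Cₙ₋₁`, so
that `J₀` is the whole algebra and `J₁` is the annihilator of the coradical. Since `J₁` is a
two-sided ideal and `Cₙ₊₁` is the set of elements killed by `J₁ * Jₙ₊₁`, one gets `Jᵢ * Jⱼ ⊆ Jᵢ₊ⱼ`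
(`mul_mem_annihilator`). Dually, `Δ(Cₙ) ⊆ ∑ Cᵢ ⊗ Cₙ₋ᵢ` (`comul_mem_tensorFiltration`), and this
makes `gr(C)` a coalgebra.

If `H` is pointed, `H₀` is spanned by group-likes, hence is closed under products and antipode.
Induction along `Δ` extends this to `Hₘ Hₙ ⊆ Hₘ₊ₙ` and `S(Hₙ) ⊆ Hₙ`, and `gr(H)` becomes a Hopf
algebra (`nonempty_degeneration`). It is pointed because slicing an element of a nonzero
subcoalgebra by a functional that sees only its top degree yields a nonzero element of degree zero,
which is a combination of group-likes (`isPointed_of_symbol`).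

The projection `gr(H) → H₀ ⊆ H` is multiplicative and a map of coalgebras, and `gr(𝓡)` is the
pullback of `𝓡` along it. Invertibility and the two multiplicativity axioms therefore pull back. The
commutation axiom takes values in `gr(H)` and does not; it is instead the leading symbol of the same
identity in `H`. For `x ∈ Hₘ`, `y ∈ Hₙ`, only the terms whose arguments of `𝓡` both lie in degree
zero contribute to degree `m + n` (`convBilin_left`, `convBilin_right`).

All identities in `gr` are checked on the classes `symbol E n x`. Extending the class map linearly
to all of `C` by an arbitrary retraction lets it be applied to tensors in `C ⊗ C` directly; only its
values on `Cₙ` matter. -/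

noncomputable section

namespace CoquasiDegeneration

open Coalgebra WithConv

/-! ### Subspaces of tensor products and functionals. -/

section LinearAlgebra

variable {k : Type*} {M N : Type*} [Field k] [AddCommGroup M] [Module k M]
  [AddCommGroup N] [Module k N]

/-- Products of coordinate functionals of two bases are the coordinates of the tensor product basis,
so they separate points. -/
lemma tmul_eq_zero_of_forall_dual {u : M ⊗[k] N}
    (h : ∀ (f : M →ₗ[k] k) (g : N →ₗ[k] k),
      LinearMap.mul' k k (TensorProduct.map f g u) = 0) : u = 0 := by
  let b := Module.Basis.ofVectorSpace k M
  let c := Module.Basis.ofVectorSpace k N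
  refine (b.tensorProduct c).ext_elem fun ⟨i, j⟩ => ?_
  have key : (b.tensorProduct c).coord (i, j) =
      LinearMap.mul' k k ∘ₗ TensorProduct.map (b.coord i) (c.coord j) := by
    ext x y
    simp [mul_comm]
  have := h (b.coord i) (c.coord j)
  rw [map_zero, Finsupp.zero_apply, ← this]
  exact LinearMap.congr_fun key u

/-- A linear projection onto a subspace. -/
def retraction (V : Submodule k M) : M →ₗ[k] V :=
  (V.subtype.exists_leftInverse_of_injective V.ker_subtype).choose

lemma retraction_apply (V : Submodule k M) (x : V) : retraction V (x : M) = x :=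
  LinearMap.congr_fun
    (V.subtype.exists_leftInverse_of_injective V.ker_subtype).choose_spec x

lemma coe_retraction_of_mem {V : Submodule k M} {x : M} (hx : x ∈ V) :
    (retraction V x : M) = x :=
  congrArg Subtype.val (retraction_apply V ⟨x, hx⟩)

/-- The annihilator criterion for membership in `M ⊗ W + V ⊗ N`. -/
lemma mem_sup_range_iff (V : Submodule k M) (W : Submodule k N) (u : M ⊗[k] N) :
    u ∈ LinearMap.range (LinearMap.lTensor M W.subtype) ⊔
        LinearMap.range (LinearMap.rTensor N V.subtype) ↔
      ∀ (f : M →ₗ[k] k) (g : N →ₗ[k] k), (∀ x ∈ V, f x = 0) → (∀ y ∈ W, g y = 0) →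
        LinearMap.mul' k k (TensorProduct.map f g u) = 0 := by
  constructor
  · intro hu f g hf hg
    obtain ⟨_, ⟨a, rfl⟩, _, ⟨b, rfl⟩, rfl⟩ := Submodule.mem_sup.1 hu
    have h1 : TensorProduct.map f g ∘ₗ LinearMap.lTensor M W.subtype = 0 := by
      ext x y
      simp [hg y y.2]
    have h2 : TensorProduct.map f g ∘ₗ LinearMap.rTensor N V.subtype = 0 := by
      ext x y
      simp [hf x x.2]
    have h1' := LinearMap.congr_fun h1 a
    have h2' := LinearMap.congr_fun h2 b
    simp only [LinearMap.comp_apply, LinearMap.zero_apply] at h1' h2'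
    simp only [map_add, h1', h2', map_zero, add_zero]
  · intro h
    let P : M →ₗ[k] M := V.subtype ∘ₗ retraction V
    let Q : N →ₗ[k] N := W.subtype ∘ₗ retraction W
    -- Any functional composed with `1 - P` or `1 - Q` annihilates `V` or `W`, so the hypothesis
    -- applies to all such pairs. What remains is the splitting `1 ⊗ 1 = (1 - P) ⊗ Q + P ⊗ 1 + (1 -
    -- P) ⊗ (1 - Q)`.
    have h0 : TensorProduct.map (LinearMap.id - P) (LinearMap.id - Q) u = 0 := by
      refine tmul_eq_zero_of_forall_dual fun f g => ?_
      have := h (f ∘ₗ (LinearMap.id - P)) (g ∘ₗ (LinearMap.id - Q))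
        (fun x hx => by simp [P, coe_retraction_of_mem hx])
        (fun x hx => by simp [Q, coe_retraction_of_mem hx])
      rwa [TensorProduct.map_comp] at this
    have h1 : u = LinearMap.lTensor M W.subtype
          (TensorProduct.map (LinearMap.id - P) (retraction W) u) +
        LinearMap.rTensor N V.subtype (TensorProduct.map (retraction V) LinearMap.id u) := by
      have e : (LinearMap.id : M ⊗[k] N →ₗ[k] M ⊗[k] N) =
          LinearMap.lTensor M W.subtype ∘ₗ
            TensorProduct.map (LinearMap.id - P) (retraction W) +
          LinearMap.rTensor N V.subtype ∘ₗ TensorProduct.map (retraction V) LinearMap.id +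
          TensorProduct.map (LinearMap.id - P) (LinearMap.id - Q) := by
        ext x y
        simp [P, Q, TensorProduct.sub_tmul, TensorProduct.tmul_sub]
        abel
      have e' := LinearMap.congr_fun e u
      simpa [h0] using e'
    rw [h1]
    exact Submodule.add_mem_sup ⟨_, rfl⟩ ⟨_, rfl⟩

lemma map_sub_left {P Q : Type*} [AddCommGroup P] [Module k P] [AddCommGroup Q] [Module k Q] (f g : M →ₗ[k] P) (h : N →ₗ[k] Q) :
    TensorProduct.map (f - g) h = TensorProduct.map f h - TensorProduct.map g h := by
  ext; simp [TensorProduct.sub_tmul]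

lemma map_sub_right {P Q : Type*} [AddCommGroup P] [Module k P] [AddCommGroup Q] [Module k Q] (f : M →ₗ[k] P) (g h : N →ₗ[k] Q) :
    TensorProduct.map f (g - h) = TensorProduct.map f g - TensorProduct.map f h := by
  ext; simp [TensorProduct.tmul_sub]

end LinearAlgebra

/-! ### Contractions of the comultiplication by functionals. -/

section Slices

variable {k : Type u} {C : Type v} [Field k] [AddCommGroup C] [Module k C] [Coalgebra k C]

/-- The contraction `x ↦ f(x₁) x₂`. -/
def leftSlice (f : C →ₗ[k] k) : C →ₗ[k] C :=
  (TensorProduct.lid k C).toLinearMap ∘ₗ LinearMap.rTensor C f ∘ₗ comul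

/-- The contraction `x ↦ x₁ g(x₂)`. -/
def rightSlice (g : C →ₗ[k] k) : C →ₗ[k] C :=
  (TensorProduct.rid k C).toLinearMap ∘ₗ LinearMap.lTensor C g ∘ₗ comul

/-- Pairing a slice with a functional is a convolution product, so associativity of convolution
decides in which filtration step a slice lies. -/
lemma apply_leftSlice (f g : C →ₗ[k] k) (x : C) :
    g (leftSlice f x) = (toConv f * toConv g) x := by
  have : g ∘ₗ (TensorProduct.lid k C).toLinearMap ∘ₗ LinearMap.rTensor C f =
      LinearMap.mul' k k ∘ₗ TensorProduct.map f g := by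
    ext a b
    simp
  exact LinearMap.congr_fun this (comul x)

lemma apply_rightSlice (f g : C →ₗ[k] k) (x : C) :
    f (rightSlice g x) = (toConv f * toConv g) x := by
  have : f ∘ₗ (TensorProduct.rid k C).toLinearMap ∘ₗ LinearMap.lTensor C g =
      LinearMap.mul' k k ∘ₗ TensorProduct.map f g := by
    ext a b
    simp [mul_comm]
  exact LinearMap.congr_fun this (comul x)

lemma counit_leftSlice (f : C →ₗ[k] k) (x : C) : counit (R := k) (leftSlice f x) = f x := by
  rw [apply_leftSlice]
  have : (toConv (counit (R := k) (A := C))) = 1 := by ext; simp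
  rw [this, mul_one]

lemma IsSubcoalgebra.leftSlice_mem {D : Submodule k C} (hD : IsSubcoalgebra k D)
    (f : C →ₗ[k] k) {x : C} (hx : x ∈ D) : leftSlice f x ∈ D := by
  obtain ⟨w, hw⟩ := hD x hx
  have : (TensorProduct.lid k C).toLinearMap ∘ₗ LinearMap.rTensor C f ∘ₗ
      TensorProduct.map D.subtype D.subtype =
      D.subtype ∘ₗ (TensorProduct.lid k D).toLinearMap ∘ₗ
        LinearMap.rTensor D (f ∘ₗ D.subtype) := by
    ext a b
    simp
  have h := LinearMap.congr_fun this w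
  simp only [LinearMap.comp_apply, hw] at h
  exact h ▸ Subtype.property _

lemma IsSubcoalgebra.rightSlice_mem {D : Submodule k C} (hD : IsSubcoalgebra k D)
    (f : C →ₗ[k] k) {x : C} (hx : x ∈ D) : rightSlice f x ∈ D := by
  obtain ⟨w, hw⟩ := hD x hx
  have : (TensorProduct.rid k C).toLinearMap ∘ₗ LinearMap.lTensor C f ∘ₗ
      TensorProduct.map D.subtype D.subtype =
      D.subtype ∘ₗ (TensorProduct.rid k D).toLinearMap ∘ₗ
        LinearMap.lTensor D (f ∘ₗ D.subtype) := by
    ext a b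
    simp
  have h := LinearMap.congr_fun this w
  simp only [LinearMap.comp_apply, hw] at h
  exact h ▸ Subtype.property _

end Slices

/-! ### The coradical filtration through annihilators in the dual algebra. -/

section Filtration

variable {k : Type u} {C : Type v} [Field k] [AddCommGroup C] [Module k C] [Coalgebra k C]

/-- The elements of the dual algebra that vanish on a subspace. -/
def annihilator (V : Submodule k C) : Set (WithConv (C →ₗ[k] k)) :=
  {f | ∀ x ∈ V, f x = 0}

/-- The dual form of the recursive definition; from here on the filtration is handled by products of
functionals. -/
lemma mem_coradicalFiltration_succ (n : ℕ) (x : C) :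
    x ∈ coradicalFiltration k C (n + 1) ↔
      ∀ f ∈ annihilator (coradical k C), ∀ g ∈ annihilator (coradicalFiltration k C n),
        (f * g) x = 0 := by
  rw [coradicalFiltration, Submodule.mem_comap, mem_sup_range_iff]
  exact ⟨fun h f hf g hg => h f.ofConv g.ofConv hf hg,
    fun h f g hf hg => h (toConv f) hf (toConv g) hg⟩

/-- Subcoalgebras are stable under slices, so the annihilator of the coradical is an ideal; this is
one side, the next lemma the other. -/
lemma mul_mem_annihilator_coradical_left {f : WithConv (C →ₗ[k] k)}
    (hf : f ∈ annihilator (coradical k C)) (g : WithConv (C →ₗ[k] k)) :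
    f * g ∈ annihilator (coradical k C) := by
  have : coradical k C ≤ LinearMap.ker (f * g).ofConv := by
    refine sSup_le fun D hD x hx => ?_
    rw [LinearMap.mem_ker]
    refine (apply_rightSlice f.ofConv g.ofConv x).symm.trans ?_
    exact hf _ ((le_sSup hD : D ≤ coradical k C) (hD.1.rightSlice_mem _ hx))
  exact this

lemma mul_mem_annihilator_coradical_right (f : WithConv (C →ₗ[k] k))
    {g : WithConv (C →ₗ[k] k)} (hg : g ∈ annihilator (coradical k C)) :
    f * g ∈ annihilator (coradical k C) := by
  have : coradical k C ≤ LinearMap.ker (f * g).ofConv := by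
    refine sSup_le fun D hD x hx => ?_
    rw [LinearMap.mem_ker]
    refine (apply_leftSlice f.ofConv g.ofConv x).symm.trans ?_
    exact hg _ ((le_sSup hD : D ≤ coradical k C) (hD.1.leftSlice_mem _ hx))
  exact this

lemma mul_mem_annihilator_succ {f g : WithConv (C →ₗ[k] k)}
    (hf : f ∈ annihilator (coradical k C)) {n : ℕ}
    (hg : g ∈ annihilator (coradicalFiltrationPred k C n)) :
    f * g ∈ annihilator (coradicalFiltrationPred k C (n + 1)) := by
  cases n with
  | zero => exact mul_mem_annihilator_coradical_left hf g
  | succ n => exact fun x hx => (mem_coradicalFiltration_succ n x).1 hx f hf g hg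

lemma mul_mem_annihilator_right (f : WithConv (C →ₗ[k] k)) {g : WithConv (C →ₗ[k] k)} (n : ℕ)
    (hg : g ∈ annihilator (coradicalFiltrationPred k C n)) :
    f * g ∈ annihilator (coradicalFiltrationPred k C n) := by
  match n with
  | 0 => exact fun x hx => by simp [(Submodule.mem_bot k).1 hx]
  | 1 => exact mul_mem_annihilator_coradical_right f hg
  | n + 2 =>
    intro x hx
    refine (apply_leftSlice f.ofConv g.ofConv x).symm.trans (hg _ ?_)
    refine (mem_coradicalFiltration_succ n _).2 fun a ha b hb => ?_
    refine (apply_leftSlice f.ofConv (a * b).ofConv x).trans ?_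
    change (f * (a * b)) x = 0
    -- Regrouped as `(f * a) * b`, where `f * a` still annihilates the coradical.
    rw [← mul_assoc]
    exact mul_mem_annihilator_succ (n := n + 1) (mul_mem_annihilator_coradical_right f ha) hb x hx

/-- The annihilators of `C₋₁ ⊆ C₀ ⊆ C₁ ⊆ ⋯` form a descending multiplicative filtration of the
dual algebra. -/
lemma mul_mem_annihilator (i j : ℕ) {f g : WithConv (C →ₗ[k] k)}
    (hf : f ∈ annihilator (coradicalFiltrationPred k C i))
    (hg : g ∈ annihilator (coradicalFiltrationPred k C j)) :
    f * g ∈ annihilator (coradicalFiltrationPred k C (i + j)) := by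
  induction i generalizing f g j with
  | zero => rw [zero_add]; exact mul_mem_annihilator_right f j hg
  | succ i ih =>
    cases i with
    | zero => rw [add_comm]; exact mul_mem_annihilator_succ hf hg
    | succ i =>
      intro x hx
      refine (apply_rightSlice f.ofConv g.ofConv x).symm.trans (hf _ ?_)
      refine (mem_coradicalFiltration_succ i _).2 fun a ha b hb => ?_
      refine (apply_rightSlice (a * b).ofConv g.ofConv x).trans ?_
      change (a * b * g) x = 0
      -- Regrouped as `a * (b * g)`: the induction hypothesis handles `b * g`, and `a` raises the
      -- index by one.
      rw [mul_assoc]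
      refine mul_mem_annihilator_succ ha (ih j hb hg) x ?_
      rwa [show i + 1 + j + 1 = i + 1 + 1 + j by ring]

lemma coradicalFiltrationPred_le (n : ℕ) :
    coradicalFiltrationPred k C n ≤ coradicalFiltration k C n := by
  induction n with
  | zero => exact bot_le
  | succ n ih =>
    intro x hx
    refine (mem_coradicalFiltration_succ n x).2 fun f hf g hg => ?_
    exact mul_mem_annihilator_succ hf (fun y hy => hg y (ih hy)) x hx

lemma coradicalFiltration_mono : Monotone (coradicalFiltration k C) :=
  monotone_nat_of_le_succ fun n => coradicalFiltrationPred_le (n + 1)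

lemma coradicalFiltration_le_pred {m n : ℕ} (h : m < n) :
    coradicalFiltration k C m ≤ coradicalFiltrationPred k C n := by
  cases n with
  | zero => omega
  | succ n => exact coradicalFiltration_mono (Nat.lt_succ_iff.1 h)

variable (k C) in
/-- The subspace `∑ Cᵢ ⊗ Cⱼ`, `i + j = n`, of `C ⊗ C`. -/
def tensorFiltration (n : ℕ) : Submodule k (C ⊗[k] C) :=
  Submodule.span k {u | ∃ i j : ℕ, i + j = n ∧
    ∃ x ∈ coradicalFiltration k C i, ∃ y ∈ coradicalFiltration k C j, u = x ⊗ₜ[k] y}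

lemma tmul_mem_tensorFiltration {i j n : ℕ} (h : i + j = n) {x y : C}
    (hx : x ∈ coradicalFiltration k C i) (hy : y ∈ coradicalFiltration k C j) :
    x ⊗ₜ[k] y ∈ tensorFiltration k C n :=
  Submodule.subset_span ⟨i, j, h, x, hx, y, hy, rfl⟩

lemma map_mem_tensorFiltration {i j n : ℕ} (h : i + j = n) {f g : C →ₗ[k] C}
    (hf : ∀ x, f x ∈ coradicalFiltration k C i) (hg : ∀ x, g x ∈ coradicalFiltration k C j)
    (u : C ⊗[k] C) : TensorProduct.map f g u ∈ tensorFiltration k C n := by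
  induction u with
  | zero => simp
  | add u v hu hv => rw [map_add]; exact add_mem hu hv
  | tmul x y => exact tmul_mem_tensorFiltration h (hf x) (hg y)

variable (k C) in
/-- A projection of `C` onto `Cₙ`. -/
def filtrationProj (n : ℕ) : C →ₗ[k] C :=
  (coradicalFiltration k C n).subtype ∘ₗ retraction (coradicalFiltration k C n)

lemma filtrationProj_mem (n : ℕ) (x : C) : filtrationProj k C n x ∈ coradicalFiltration k C n :=
  Subtype.property _

lemma filtrationProj_of_mem {n : ℕ} {x : C} (hx : x ∈ coradicalFiltration k C n) :
    filtrationProj k C n x = x :=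
  coe_retraction_of_mem hx

variable (k C) in
/-- The difference of the projections onto `Cₙ` and onto `Cₙ₋₁`. -/
def filtrationDiff : ℕ → C →ₗ[k] C
  | 0 => filtrationProj k C 0
  | n + 1 => filtrationProj k C (n + 1) - filtrationProj k C n

lemma filtrationDiff_mem (n : ℕ) (x : C) :
    filtrationDiff k C n x ∈ coradicalFiltration k C n := by
  cases n with
  | zero => exact filtrationProj_mem 0 x
  | succ n =>
    exact sub_mem (filtrationProj_mem _ _)
      (coradicalFiltration_mono n.le_succ (filtrationProj_mem n x))

lemma filtrationDiff_of_mem_pred {n : ℕ} {x : C} (hx : x ∈ coradicalFiltrationPred k C n) :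
    filtrationDiff k C n x = 0 := by
  cases n with
  | zero => simp [(Submodule.mem_bot k).1 hx]
  | succ n =>
    rw [filtrationDiff, LinearMap.sub_apply, filtrationProj_of_mem hx,
      filtrationProj_of_mem (coradicalFiltration_mono n.le_succ hx), sub_self]

lemma sum_filtrationDiff (n : ℕ) :
    ∑ i ∈ Finset.range (n + 1), filtrationDiff k C i = filtrationProj k C n := by
  induction n with
  | zero => simp [filtrationDiff]
  | succ n ih => rw [Finset.sum_range_succ, ih, filtrationDiff, add_sub_cancel]

/-- After composition with functionals, `p` and `q` give elements of `Jᵢ` and `Jⱼ`, whose product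
lies in `Jₙ₊₁`, the annihilator of `Cₙ`. -/
lemma map_comul_eq_zero {i j n : ℕ} (h : i + j = n + 1) {M N : Type*} [AddCommGroup M]
    [Module k M] [AddCommGroup N] [Module k N] {p : C →ₗ[k] M} {q : C →ₗ[k] N}
    (hp : ∀ x ∈ coradicalFiltrationPred k C i, p x = 0)
    (hq : ∀ x ∈ coradicalFiltrationPred k C j, q x = 0)
    {x : C} (hx : x ∈ coradicalFiltration k C n) :
    TensorProduct.map p q (comul (R := k) x) = 0 := by
  refine tmul_eq_zero_of_forall_dual fun f g => ?_
  rw [← LinearMap.comp_apply (TensorProduct.map f g), ← TensorProduct.map_comp]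
  refine mul_mem_annihilator i j (f := toConv (f ∘ₗ p)) (g := toConv (g ∘ₗ q))
    (fun y hy => ?_) (fun y hy => ?_) x (h ▸ hx)
  · simp [hp y hy]
  · simp [hq y hy]

/-- The first tensor factor may be projected to `Cₙ`, and that projection telescopes into
differences `dᵢ`. As `dᵢ` kills `Cᵢ₋₁`, next to it the second factor may be projected to `Cₙ₋ᵢ`
without change. -/
theorem comul_mem_tensorFiltration {n : ℕ} {x : C} (hx : x ∈ coradicalFiltration k C n) :
    comul (R := k) x ∈ tensorFiltration k C n := by
  have h1 : TensorProduct.map (LinearMap.id - filtrationProj k C n) LinearMap.id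
      (comul (R := k) x) = 0 :=
    map_comul_eq_zero (i := n + 1) (j := 0) rfl
      (fun y hy => by simp [filtrationProj_of_mem (n := n) hy])
      (fun y hy => (Submodule.mem_bot k).1 hy) hx
  have h2 : ∀ i ∈ Finset.range (n + 1), TensorProduct.map (filtrationDiff k C i)
      (LinearMap.id - filtrationProj k C (n - i)) (comul (R := k) x) = 0 := fun i hi =>
    map_comul_eq_zero (i := i) (j := n - i + 1)
      (by have := Finset.mem_range.1 hi; omega)
      (fun y hy => filtrationDiff_of_mem_pred hy)
      (fun y hy => by simp [filtrationProj_of_mem (n := n - i) hy]) hx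
  have h3 : comul (R := k) x = ∑ i ∈ Finset.range (n + 1),
      TensorProduct.map (filtrationDiff k C i) (filtrationProj k C (n - i))
        (comul (R := k) x) := by
    rw [map_sub_left, LinearMap.sub_apply, sub_eq_zero, TensorProduct.map_id,
      LinearMap.id_apply, ← sum_filtrationDiff] at h1
    have h4 : TensorProduct.map (∑ i ∈ Finset.range (n + 1), filtrationDiff k C i)
        (LinearMap.id : C →ₗ[k] C) = ∑ i ∈ Finset.range (n + 1),
          TensorProduct.map (filtrationDiff k C i) (LinearMap.id : C →ₗ[k] C) := by
      ext a b
      simp [TensorProduct.sum_tmul]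
    rw [h4, LinearMap.sum_apply] at h1
    refine h1.trans (Finset.sum_congr rfl fun i hi => ?_)
    have := h2 i hi
    rwa [map_sub_right, LinearMap.sub_apply, sub_eq_zero] at this
  rw [h3]
  refine sum_mem fun i hi => map_mem_tensorFiltration ?_ (filtrationDiff_mem i)
    (filtrationProj_mem (n - i)) _
  have := Finset.mem_range.1 hi
  omega

end Filtration

/-! ### Classes in the associated graded space and in its tensor square. -/

section Symbol

variable {k : Type u} {C : Type v} [Field k] [AddCommGroup C] [Module k C] [Coalgebra k C]
  {A : Type*} [AddCommGroup A] [Module k A] (E : Gr k C ≃ₗ[k] A)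
  {W : Type*} [AddCommGroup W] [Module k W]

/-- A linear extension to `C` of the map that sends `x ∈ Cₙ` to its class in degree `n`, with
values in a copy of `gr(C)`. -/
def symbol (n : ℕ) : C →ₗ[k] A :=
  E.toLinearMap ∘ₗ grClass k C n ∘ₗ retraction (coradicalFiltration k C n)

lemma symbol_coe (n : ℕ) (x : coradicalFiltration k C n) :
    symbol E n (x : C) = E (grClass k C n x) := by
  simp [symbol, retraction_apply]

lemma symbol_of_mem_pred {n : ℕ} {x : C} (hx : x ∈ coradicalFiltrationPred k C n) :
    symbol E n x = 0 := by
  have h : grClass k C n ⟨x, coradicalFiltrationPred_le n hx⟩ = 0 := by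
    rw [grClass, LinearMap.comp_apply, Submodule.mkQ_apply,
      (Submodule.Quotient.mk_eq_zero _).2 (by exact hx), map_zero]
  exact (symbol_coe E n ⟨x, coradicalFiltrationPred_le n hx⟩).trans (by rw [h, map_zero])

lemma symbol_of_lt {m n : ℕ} (h : m < n) {x : C} (hx : x ∈ coradicalFiltration k C m) :
    symbol E n x = 0 :=
  symbol_of_mem_pred E (coradicalFiltration_le_pred h hx)

lemma gr_hom_ext {f g : A →ₗ[k] W}
    (h : ∀ n, ∀ x ∈ coradicalFiltration k C n, f (symbol E n x) = g (symbol E n x)) : f = g := by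
  have : f ∘ₗ E.toLinearMap = g ∘ₗ E.toLinearMap := by
    refine DirectSum.linearMap_ext k fun n => Submodule.linearMap_qext _ (LinearMap.ext fun x => ?_)
    have := h n x x.2
    rwa [symbol_coe] at this
  ext a
  simpa using LinearMap.congr_fun this (E.symm a)

lemma gr_induction {p : A → Prop} (zero : p 0) (add : ∀ a b, p a → p b → p (a + b))
    (symbol : ∀ n, ∀ x ∈ coradicalFiltration k C n, p (symbol E n x)) (a : A) : p a := by
  obtain ⟨z, rfl⟩ := E.surjective a
  induction z using DirectSum.induction_on with
  | zero => rwa [map_zero]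
  | add x y hx hy => rw [map_add]; exact add _ _ hx hy
  | of n y =>
    obtain ⟨x, rfl⟩ := Submodule.Quotient.mk_surjective _ y
    have := symbol n x x.2
    rwa [symbol_coe] at this

/-- The linear map on `gr(C)` induced by maps that vanish on the preceding term of the
filtration. -/
def grLift (f : ℕ → C →ₗ[k] W) (hf : ∀ n, ∀ x ∈ coradicalFiltrationPred k C n, f n x = 0) :
    A →ₗ[k] W :=
  DirectSum.toModule k ℕ W (fun n =>
    ((coradicalFiltrationPred k C n).comap (coradicalFiltration k C n).subtype).liftQ
      (f n ∘ₗ (coradicalFiltration k C n).subtype) (fun x hx => hf n x hx)) ∘ₗ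
    E.symm.toLinearMap

lemma grLift_symbol (f : ℕ → C →ₗ[k] W)
    (hf : ∀ n, ∀ x ∈ coradicalFiltrationPred k C n, f n x = 0) {n : ℕ} {x : C}
    (hx : x ∈ coradicalFiltration k C n) : grLift E f hf (symbol E n x) = f n x := by
  rw [symbol_coe E n ⟨x, hx⟩]
  simp only [grLift, LinearMap.comp_apply, LinearEquiv.coe_coe, LinearEquiv.symm_apply_apply,
    grClass]
  erw [DirectSum.toModule_lof]
  rfl

/-- The bilinear map on `gr(C)` induced by bilinear maps that vanish on the preceding terms of the
filtration. -/
def grLift₂ (B : ℕ → ℕ → C →ₗ[k] C →ₗ[k] W)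
    (hl : ∀ m n, ∀ x ∈ coradicalFiltrationPred k C m, ∀ y ∈ coradicalFiltration k C n,
      B m n x y = 0)
    (hr : ∀ m n, ∀ x ∈ coradicalFiltration k C m, ∀ y ∈ coradicalFiltrationPred k C n,
      B m n x y = 0) : A →ₗ[k] A →ₗ[k] W :=
  grLift E (fun m =>
    -- The projection is needed because `hr` applies only to `x ∈ Cₘ`, while the outer lift asks for
    -- a map on all of `C`.
    { toFun := fun x => grLift E (fun n => B m n (filtrationProj k C m x))
        (fun n y hy => hr m n _ (filtrationProj_mem m x) y hy)
      map_add' := fun x y => gr_hom_ext E fun n z hz => by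
        simp [grLift_symbol E _ _ hz]
      map_smul' := fun c x => gr_hom_ext E fun n z hz => by
        simp [grLift_symbol E _ _ hz] })
    (fun m x hx => gr_hom_ext E fun n z hz => by
      simp only [LinearMap.coe_mk, AddHom.coe_mk, LinearMap.zero_apply]
      rw [grLift_symbol E _ _ hz, filtrationProj_of_mem (coradicalFiltrationPred_le m hx)]
      exact hl m n x hx z hz)

lemma grLift₂_symbol (B : ℕ → ℕ → C →ₗ[k] C →ₗ[k] W)
    (hl : ∀ m n, ∀ x ∈ coradicalFiltrationPred k C m, ∀ y ∈ coradicalFiltration k C n,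
      B m n x y = 0)
    (hr : ∀ m n, ∀ x ∈ coradicalFiltration k C m, ∀ y ∈ coradicalFiltrationPred k C n,
      B m n x y = 0) {m n : ℕ} {x y : C} (hx : x ∈ coradicalFiltration k C m)
    (hy : y ∈ coradicalFiltration k C n) :
    grLift₂ E B hl hr (symbol E m x) (symbol E n y) = B m n x y := by
  rw [grLift₂, grLift_symbol E _ _ hx]
  simp only [LinearMap.coe_mk, AddHom.coe_mk]
  rw [grLift_symbol E _ _ hy, filtrationProj_of_mem hx]

/-- Any other pair `(a, b)` with `a + b = i + j` has `a > i` or `b > j`, so one of its factors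
vanishes. -/
lemma sum_antidiagonal_map_tmul {M N M' N' : Type*} [AddCommGroup M] [Module k M]
    [AddCommGroup N] [Module k N] [AddCommGroup M'] [Module k M'] [AddCommGroup N'] [Module k N']
    (f : ℕ → M →ₗ[k] M') (g : ℕ → N →ₗ[k] N') {i j n : ℕ} (h : i + j = n) {x : M} {y : N}
    (hx : ∀ a, i < a → f a x = 0) (hy : ∀ b, j < b → g b y = 0) :
    (∑ p ∈ Finset.HasAntidiagonal.antidiagonal n, TensorProduct.map (f p.1) (g p.2)) (x ⊗ₜ[k] y) =
      f i x ⊗ₜ[k] g j y := by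
  rw [LinearMap.sum_apply, Finset.sum_eq_single (i, j)]
  · simp
  · rintro ⟨a, b⟩ hab hne
    rw [Finset.HasAntidiagonal.mem_antidiagonal] at hab
    rw [TensorProduct.map_tmul]
    rcases lt_trichotomy i a with h1 | h1 | h1
    · rw [hx a h1, TensorProduct.zero_tmul]
    · exact absurd (by ext <;> simp only at hab ⊢ <;> omega) hne
    · rw [hy b (by simp only at hab; omega), TensorProduct.tmul_zero]
  · intro hn
    exact absurd (Finset.HasAntidiagonal.mem_antidiagonal.2 h) hn

/-- The extension to `C ⊗ C` of the map from `∑ Cᵢ ⊗ Cⱼ`, `i + j = n`, to the component of degree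
`n` of `gr(C) ⊗ gr(C)`. -/
def tensorSymbol (n : ℕ) : C ⊗[k] C →ₗ[k] A ⊗[k] A :=
  ∑ p ∈ Finset.HasAntidiagonal.antidiagonal n, TensorProduct.map (symbol E p.1) (symbol E p.2)

lemma tensorSymbol_tmul {i j n : ℕ} (h : i + j = n) {x y : C}
    (hx : x ∈ coradicalFiltration k C i) (hy : y ∈ coradicalFiltration k C j) :
    tensorSymbol E n (x ⊗ₜ[k] y) = symbol E i x ⊗ₜ[k] symbol E j y :=
  sum_antidiagonal_map_tmul _ _ h (fun _ ha => symbol_of_lt E ha hx)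
    (fun _ hb => symbol_of_lt E hb hy)

/-- Two linear maps on `C ⊗ C` agree on `∑ Cᵢ ⊗ Cⱼ`, `i + j = n`, if they agree on its pure
tensors. -/
lemma eq_on_tensorFiltration {n : ℕ} {f g : C ⊗[k] C →ₗ[k] W}
    (h : ∀ i j, i + j = n → ∀ x ∈ coradicalFiltration k C i, ∀ y ∈ coradicalFiltration k C j,
      f (x ⊗ₜ[k] y) = g (x ⊗ₜ[k] y)) {u : C ⊗[k] C} (hu : u ∈ tensorFiltration k C n) :
    f u = g u := by
  have : tensorFiltration k C n ≤ LinearMap.eqLocus f g := by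
    refine Submodule.span_le.2 ?_
    rintro _ ⟨i, j, hij, x, hx, y, hy, rfl⟩
    exact h i j hij x hx y hy
  exact this hu

lemma tensorSymbol_of_lt {m n : ℕ} (h : m < n) {u : C ⊗[k] C}
    (hu : u ∈ tensorFiltration k C m) : tensorSymbol E n u = 0 := by
  refine eq_on_tensorFiltration (g := 0) (fun i j hij x hx y hy => ?_) hu
  rw [tensorSymbol_tmul E (i := i) (j := n - i) (by omega) hx
    (coradicalFiltration_mono (by omega) hy), symbol_of_lt E (show j < n - i by omega) hy,
    TensorProduct.tmul_zero, LinearMap.zero_apply]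

/-- This makes the comultiplication of `gr(C)` well defined on `Cₙ / Cₙ₋₁`. -/
lemma tensorSymbol_comul_of_mem_pred {n : ℕ} {x : C} (hx : x ∈ coradicalFiltrationPred k C n) :
    tensorSymbol E n (comul (R := k) x) = 0 := by
  cases n with
  | zero => simp [(Submodule.mem_bot k).1 hx]
  | succ n => exact tensorSymbol_of_lt E n.lt_succ_self (comul_mem_tensorFiltration hx)

lemma exists_eq_sum_of_mem_tensorFiltration {n : ℕ} {u : C ⊗[k] C} (hu : u ∈ tensorFiltration k C n) :
    ∃ w : ∀ i j : ℕ, coradicalFiltration k C i ⊗[k] coradicalFiltration k C j,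
      u = ∑ p ∈ Finset.HasAntidiagonal.antidiagonal n,
        TensorProduct.map (coradicalFiltration k C p.1).subtype
          (coradicalFiltration k C p.2).subtype (w p.1 p.2) := by
  induction hu using Submodule.span_induction with
  | mem u h =>
    obtain ⟨i, j, hij, x, hx, y, hy, rfl⟩ := h
    -- A pure tensor gives the family concentrated at the single index `(i, j)`.
    refine ⟨fun a b => if h : a = i ∧ b = j then
      (⟨x, h.1 ▸ hx⟩ : coradicalFiltration k C a) ⊗ₜ[k]
        (⟨y, h.2 ▸ hy⟩ : coradicalFiltration k C b) else 0, ?_⟩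
    rw [Finset.sum_eq_single (i, j)]
    · simp
    · rintro ⟨a, b⟩ _ hne
      have : ¬(a = i ∧ b = j) := fun h => hne (Prod.ext h.1 h.2)
      simp only [dif_neg this, map_zero]
    · exact fun h => absurd (Finset.HasAntidiagonal.mem_antidiagonal.2 hij) h
  | zero => exact ⟨fun _ _ => 0, by simp⟩
  | add u v _ _ hu hv =>
    obtain ⟨w, rfl⟩ := hu
    obtain ⟨w', rfl⟩ := hv
    exact ⟨fun i j => w i j + w' i j, by simp [Finset.sum_add_distrib]⟩
  | smul c u _ hu =>
    obtain ⟨w, rfl⟩ := hu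
    exact ⟨fun i j => c • w i j, by simp [Finset.smul_sum]⟩

lemma tensorSymbol_sum (n : ℕ)
    (w : ∀ i j : ℕ, coradicalFiltration k C i ⊗[k] coradicalFiltration k C j) :
    tensorSymbol E n (∑ p ∈ Finset.HasAntidiagonal.antidiagonal n,
        TensorProduct.map (coradicalFiltration k C p.1).subtype
          (coradicalFiltration k C p.2).subtype (w p.1 p.2)) =
      ∑ p ∈ Finset.HasAntidiagonal.antidiagonal n,
        TensorProduct.map (E.toLinearMap ∘ₗ grClass k C p.1)
          (E.toLinearMap ∘ₗ grClass k C p.2) (w p.1 p.2) := by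
  rw [map_sum]
  refine Finset.sum_congr rfl fun p hp => ?_
  rw [← LinearMap.comp_apply]
  congr 1
  ext x y
  simpa [symbol_coe] using
    tensorSymbol_tmul E (Finset.HasAntidiagonal.mem_antidiagonal.1 hp) x.2 y.2

end Symbol

/-! ### The coalgebra `gr(C)`. -/

section GradedCoalgebra

variable {k : Type u} {C : Type v} [Field k] [AddCommGroup C] [Module k C] [Coalgebra k C]
  {A : Type*} [AddCommGroup A] [Module k A] (E : Gr k C ≃ₗ[k] A)

/-- The comultiplication of `gr(C)`. -/
def grComul : A →ₗ[k] A ⊗[k] A :=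
  grLift E (fun n => tensorSymbol E n ∘ₗ comul) (fun _ _ hx => tensorSymbol_comul_of_mem_pred E hx)

lemma grComul_symbol {n : ℕ} {x : C} (hx : x ∈ coradicalFiltration k C n) :
    grComul E (symbol E n x) = tensorSymbol E n (comul (R := k) x) :=
  grLift_symbol E _ _ hx

/-- The counit of `gr(C)`. -/
def grCounit : A →ₗ[k] k :=
  grLift E (fun n => if n = 0 then counit else 0) (fun n x hx => by
    cases n with
    | zero => simp [(Submodule.mem_bot k).1 hx]
    | succ n => simp)

lemma grCounit_symbol {n : ℕ} {x : C} (hx : x ∈ coradicalFiltration k C n) :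
    grCounit E (symbol E n x) = if n = 0 then counit (R := k) x else 0 := by
  rw [grCounit, grLift_symbol E _ _ hx]
  split_ifs <;> rfl

/-- The extension to `C ⊗ (C ⊗ C)` of the map from `∑ Cₕ ⊗ Cᵢ ⊗ Cⱼ`, `h + i + j = n`, to the
component of degree `n` of `gr(C) ⊗ (gr(C) ⊗ gr(C))`. -/
def tripleSymbol (n : ℕ) : C ⊗[k] (C ⊗[k] C) →ₗ[k] A ⊗[k] (A ⊗[k] A) :=
  ∑ p ∈ Finset.HasAntidiagonal.antidiagonal n,
    TensorProduct.map (symbol E p.1) (tensorSymbol E p.2)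

lemma tripleSymbol_tmul {i j n : ℕ} (h : i + j = n) {x : C} {u : C ⊗[k] C}
    (hx : x ∈ coradicalFiltration k C i) (hu : u ∈ tensorFiltration k C j) :
    tripleSymbol E n (x ⊗ₜ[k] u) = symbol E i x ⊗ₜ[k] tensorSymbol E j u :=
  sum_antidiagonal_map_tmul _ _ h (fun _ ha => symbol_of_lt E ha hx)
    (fun _ hb => tensorSymbol_of_lt E hb hu)

/-- With `assoc_rTensor_grComul`, this writes both iterated comultiplications of `gr(C)` as
`tripleSymbol` of those of `C`, so coassociativity is inherited. -/
lemma lTensor_grComul {n : ℕ} {u : C ⊗[k] C} (hu : u ∈ tensorFiltration k C n) :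
    (grComul E).lTensor A (tensorSymbol E n u) =
      tripleSymbol E n ((comul (R := k)).lTensor C u) := by
  refine eq_on_tensorFiltration (f := (grComul E).lTensor A ∘ₗ tensorSymbol E n)
    (g := tripleSymbol E n ∘ₗ (comul (R := k)).lTensor C) (fun i j hij x hx y hy => ?_) hu
  simp only [LinearMap.comp_apply, LinearMap.lTensor_tmul]
  rw [tensorSymbol_tmul E hij hx hy, LinearMap.lTensor_tmul, grComul_symbol E hy,
    tripleSymbol_tmul E hij hx (comul_mem_tensorFiltration hy)]

lemma assoc_tensorSymbol_tmul {i j n : ℕ} (h : i + j = n) {u : C ⊗[k] C} {y : C}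
    (hu : u ∈ tensorFiltration k C i) (hy : y ∈ coradicalFiltration k C j) :
    TensorProduct.assoc k A A A (tensorSymbol E i u ⊗ₜ[k] symbol E j y) =
      tripleSymbol E n (TensorProduct.assoc k C C C (u ⊗ₜ[k] y)) := by
  refine eq_on_tensorFiltration
    (f := (TensorProduct.assoc k A A A).toLinearMap ∘ₗ
      (TensorProduct.mk k _ A).flip (symbol E j y) ∘ₗ tensorSymbol E i)
    (g := tripleSymbol E n ∘ₗ (TensorProduct.assoc k C C C).toLinearMap ∘ₗ
      (TensorProduct.mk k _ C).flip y) (fun a b hab x hx z hz => ?_) hu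
  simp only [LinearMap.comp_apply, LinearMap.flip_apply, TensorProduct.mk_apply,
    LinearEquiv.coe_coe, TensorProduct.assoc_tmul]
  rw [tensorSymbol_tmul E hab hx hz, TensorProduct.assoc_tmul,
    tripleSymbol_tmul E (i := a) (j := b + j) (by omega) hx (tmul_mem_tensorFiltration rfl hz hy),
    tensorSymbol_tmul E rfl hz hy]

lemma assoc_rTensor_grComul {n : ℕ} {u : C ⊗[k] C} (hu : u ∈ tensorFiltration k C n) :
    TensorProduct.assoc k A A A ((grComul E).rTensor A (tensorSymbol E n u)) =
      tripleSymbol E n (TensorProduct.assoc k C C C ((comul (R := k)).rTensor C u)) := by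
  refine eq_on_tensorFiltration
    (f := (TensorProduct.assoc k A A A).toLinearMap ∘ₗ (grComul E).rTensor A ∘ₗ tensorSymbol E n)
    (g := tripleSymbol E n ∘ₗ (TensorProduct.assoc k C C C).toLinearMap ∘ₗ
      (comul (R := k)).rTensor C) (fun i j hij x hx y hy => ?_) hu
  simp only [LinearMap.comp_apply, LinearMap.rTensor_tmul, LinearEquiv.coe_coe]
  rw [tensorSymbol_tmul E hij hx hy, LinearMap.rTensor_tmul, grComul_symbol E hx,
    assoc_tensorSymbol_tmul E hij (comul_mem_tensorFiltration hx) hy]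

lemma rTensor_grCounit {n : ℕ} {u : C ⊗[k] C} (hu : u ∈ tensorFiltration k C n) :
    (grCounit E).rTensor A (tensorSymbol E n u) =
      (symbol E n).lTensor k ((counit (R := k)).rTensor C u) := by
  refine eq_on_tensorFiltration (f := (grCounit E).rTensor A ∘ₗ tensorSymbol E n)
    (g := (symbol E n).lTensor k ∘ₗ (counit (R := k)).rTensor C) (fun i j hij x hx y hy => ?_) hu
  simp only [LinearMap.comp_apply, LinearMap.rTensor_tmul, LinearMap.lTensor_tmul]
  rw [tensorSymbol_tmul E hij hx hy, LinearMap.rTensor_tmul, grCounit_symbol E hx]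
  split_ifs with h
  · rw [show j = n by omega]
  · rw [symbol_of_lt E (show j < n by omega) hy, TensorProduct.zero_tmul, TensorProduct.tmul_zero]

lemma lTensor_grCounit {n : ℕ} {u : C ⊗[k] C} (hu : u ∈ tensorFiltration k C n) :
    (grCounit E).lTensor A (tensorSymbol E n u) =
      (symbol E n).rTensor k ((counit (R := k)).lTensor C u) := by
  refine eq_on_tensorFiltration (f := (grCounit E).lTensor A ∘ₗ tensorSymbol E n)
    (g := (symbol E n).rTensor k ∘ₗ (counit (R := k)).lTensor C) (fun i j hij x hx y hy => ?_) hu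
  simp only [LinearMap.comp_apply, LinearMap.rTensor_tmul, LinearMap.lTensor_tmul]
  rw [tensorSymbol_tmul E hij hx hy, LinearMap.lTensor_tmul, grCounit_symbol E hy]
  split_ifs with h
  · rw [show i = n by omega]
  · rw [symbol_of_lt E (show i < n by omega) hx, TensorProduct.zero_tmul, TensorProduct.tmul_zero]

/-- The coalgebra structure of `gr(C)`. -/
abbrev grCoalgebra : Coalgebra k A where
  comul := grComul E
  counit := grCounit E
  coassoc := gr_hom_ext E fun n x hx => by
    have hu := comul_mem_tensorFiltration hx
    simp only [LinearMap.comp_apply, LinearEquiv.coe_coe, grComul_symbol E hx]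
    rw [assoc_rTensor_grComul E hu, lTensor_grComul E hu, coassoc_apply]
  rTensor_counit_comp_comul := gr_hom_ext E fun n x hx => by
    simp only [LinearMap.comp_apply, grComul_symbol E hx]
    rw [rTensor_grCounit E (comul_mem_tensorFiltration hx), rTensor_counit_comul,
      LinearMap.lTensor_tmul, TensorProduct.mk_apply]
  lTensor_counit_comp_comul := gr_hom_ext E fun n x hx => by
    simp only [LinearMap.comp_apply, grComul_symbol E hx]
    rw [lTensor_grCounit E (comul_mem_tensorFiltration hx), lTensor_counit_comul,
      LinearMap.rTensor_tmul, LinearMap.flip_apply, TensorProduct.mk_apply]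

end GradedCoalgebra

/-! ### Group-like elements and the coradical of a pointed coalgebra. -/

section GroupLike

variable {k : Type u} {C : Type v} [Field k] [AddCommGroup C] [Module k C] [Coalgebra k C]

lemma isSubcoalgebra_span_singleton {g : C} (hg : IsGroupLikeElem k g) :
    IsSubcoalgebra k (k ∙ g) := by
  intro x hx
  obtain ⟨c, rfl⟩ := Submodule.mem_span_singleton.1 hx
  refine ⟨c • (⟨g, Submodule.mem_span_singleton_self g⟩ ⊗ₜ[k]
    ⟨g, Submodule.mem_span_singleton_self g⟩), ?_⟩
  simp [hg.comul_eq_tmul_self]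

lemma isSimpleSubcoalgebra_span_singleton {g : C} (hg : IsGroupLikeElem k g) :
    IsSimpleSubcoalgebra k (k ∙ g) := by
  refine ⟨isSubcoalgebra_span_singleton hg, ?_, fun E _ hE => ?_⟩
  · simpa using hg.ne_zero
  · exact (nonzero_span_atom g hg.ne_zero).le_iff.1 hE

lemma isGroupLikeElem_mem_coradical {g : C} (hg : IsGroupLikeElem k g) :
    g ∈ coradical k C :=
  (le_sSup (isSimpleSubcoalgebra_span_singleton hg) : (k ∙ g) ≤ coradical k C)
    (Submodule.mem_span_singleton_self g)

/-- A one-dimensional subcoalgebra is spanned by a group-like element. -/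
lemma IsSubcoalgebra.le_span_groupLike {D : Submodule k C} (hD : IsSubcoalgebra k D)
    (h1 : Module.finrank k D = 1) : D ≤ Submodule.span k {g | IsGroupLikeElem k g} := by
  obtain ⟨v, hv, hspan⟩ := finrank_eq_one_iff'.1 h1
  have hT : ∀ u : D ⊗[k] D, ∃ c : k, u = c • (v ⊗ₜ[k] v) := by
    intro u
    induction u with
    | zero => exact ⟨0, by simp⟩
    | add u w hu hw =>
      obtain ⟨a, rfl⟩ := hu
      obtain ⟨b, rfl⟩ := hw
      exact ⟨a + b, (add_smul _ _ _).symm⟩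
    | tmul x y =>
      obtain ⟨a, rfl⟩ := hspan x
      obtain ⟨b, rfl⟩ := hspan y
      exact ⟨a * b, by rw [TensorProduct.smul_tmul_smul]⟩
  obtain ⟨u, hu⟩ := hD v v.2
  obtain ⟨c, rfl⟩ := hT u
  have hΔ : comul (R := k) (v : C) = c • ((v : C) ⊗ₜ[k] (v : C)) := by
    rw [← hu, map_smul, TensorProduct.map_tmul, Submodule.subtype_apply]
  have hv0 : (v : C) ≠ 0 := fun h => hv (Subtype.ext h)
  -- The counit axiom applied to `Δ(v) = c (v ⊗ v)` fixes the normalisation: `c • v` is group-like.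
  have hc : c * counit (R := k) (v : C) = 1 := by
    have h := rTensor_counit_comul (R := k) (v : C)
    rw [hΔ, map_smul, LinearMap.rTensor_tmul] at h
    have h' := congrArg (TensorProduct.lid k C) h
    rw [map_smul, TensorProduct.lid_tmul, TensorProduct.lid_tmul, one_smul, smul_smul] at h'
    exact smul_left_injective k hv0 (h'.trans (one_smul k (v : C)).symm)
  have hg : IsGroupLikeElem k (c • (v : C)) := by
    constructor
    · rw [map_smul, smul_eq_mul, hc]
    · rw [map_smul, hΔ, TensorProduct.smul_tmul_smul, smul_smul]
  intro x hx
  obtain ⟨a, ha⟩ := hspan ⟨x, hx⟩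
  have hx' : x = (a * counit (R := k) (v : C)) • (c • (v : C)) := by
    rw [smul_smul, mul_assoc, mul_comm _ c, hc, mul_one]
    exact (congrArg Subtype.val ha).symm
  rw [hx']
  exact Submodule.smul_mem _ _ (Submodule.subset_span hg)

/-- The coradical of a pointed coalgebra is spanned by the group-like elements. -/
lemma IsPointed.coradical_eq_span (hC : IsPointed k C) :
    coradical k C = Submodule.span k {g | IsGroupLikeElem k g} :=
  le_antisymm (sSup_le fun D hD => hD.1.le_span_groupLike (hC D hD))
    (Submodule.span_le.2 fun _ hg => isGroupLikeElem_mem_coradical hg)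

end GroupLike

/-! ### Compatibility of the antipode with the comultiplication. -/

section AntipodeComul

variable {k : Type u} {H : Type v} [CommSemiring k] [Semiring H] [HopfAlgebra k H]

open HopfAlgebra

/-- In Sweedler notation `(S(x₁) ⊗ S(a)) Δ(x₂) = S(x₁)x₂ ⊗ S(a)x₃ = 1 ⊗ S(a)x`. -/
lemma sum_antipode_tmul_mul_comul (a x : H) :
    LinearMap.mul' k (H ⊗[k] H)
      (TensorProduct.map ((TensorProduct.mk k H H).flip (antipode k a) ∘ₗ antipode k) comul
        (comul (R := k) x)) = 1 ⊗ₜ[k] (antipode k a * x) := by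
  let Θ : H ⊗[k] (H ⊗[k] H) →ₗ[k] H ⊗[k] H :=
    TensorProduct.map (LinearMap.mul' k H) (LinearMap.mulLeft k (antipode k a)) ∘ₗ
      (TensorProduct.assoc k H H H).symm.toLinearMap ∘ₗ
        LinearMap.rTensor (H ⊗[k] H) (antipode k)
  have h1 : LinearMap.mul' k (H ⊗[k] H) ∘ₗ
      TensorProduct.map ((TensorProduct.mk k H H).flip (antipode k a) ∘ₗ antipode k) comul =
      Θ ∘ₗ LinearMap.lTensor H comul := by
    refine TensorProduct.ext' fun b y => ?_
    simp only [Θ, LinearMap.comp_apply, TensorProduct.map_tmul, LinearMap.lTensor_tmul,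
      LinearMap.mul'_apply, LinearMap.flip_apply, TensorProduct.mk_apply, LinearMap.rTensor_tmul]
    generalize comul (R := k) y = w
    induction w with
    | zero => simp
    | add u v hu hv => rw [mul_add, hu, hv, TensorProduct.tmul_add, map_add, map_add]
    | tmul c d => simp
  have h2 : Θ ∘ₗ (TensorProduct.assoc k H H H).toLinearMap ∘ₗ LinearMap.rTensor H comul =
      TensorProduct.map (Algebra.linearMap k H ∘ₗ counit) (LinearMap.mulLeft k (antipode k a)) := by
    refine TensorProduct.ext' fun y d => ?_
    simp only [Θ, LinearMap.comp_apply, TensorProduct.map_tmul, LinearMap.rTensor_tmul,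
      Algebra.linearMap_apply, LinearEquiv.coe_coe]
    rw [← mul_antipode_rTensor_comul_apply (R := k) y]
    generalize comul (R := k) y = w
    induction w with
    | zero => simp
    | add u v hu hv => simp only [TensorProduct.add_tmul, map_add, hu, hv]
    | tmul c d => simp
  have h3 : TensorProduct.map (Algebra.linearMap k H ∘ₗ counit (R := k))
      (LinearMap.mulLeft k (antipode k a)) =
      TensorProduct.map (Algebra.linearMap k H) (LinearMap.mulLeft k (antipode k a)) ∘ₗ
        LinearMap.rTensor H (counit (R := k) (A := H)) := by
    ext; simp
  calc _ = Θ (LinearMap.lTensor H (comul (R := k)) (comul (R := k) x)) := LinearMap.congr_fun h1 _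
    _ = Θ (TensorProduct.assoc k H H H (LinearMap.rTensor H (comul (R := k)) (comul (R := k) x))) := by
      rw [coassoc_apply]
    _ = _ := LinearMap.congr_fun h2 _
    _ = _ := by
      rw [h3, LinearMap.comp_apply, rTensor_counit_comul]
      simp

variable (k H) in
/-- The antipode of a Hopf algebra is an antihomomorphism of coalgebras. -/
lemma comul_comp_antipode :
    comul ∘ₗ antipode k =
      TensorProduct.map (antipode k) (antipode k) ∘ₗ
        (TensorProduct.comm k H H).toLinearMap ∘ₗ comul (R := k) := by
  refine toConv_injective (Eq.symm ?_)
  -- Both sides are convolution inverses of `Δ`. It remains to see that `x ↦ S(x₂) ⊗ S(x₁)` is a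
  -- left inverse: `S(x₂)x₃ ⊗ S(x₁)x₄ = 1 ⊗ S(x₁)x₂ = ε(x) 1 ⊗ 1`.
  refine left_inv_eq_right_inv (a := toConv (comul (R := k) (A := H))) ?_
    LinearMap.comul_right_inv
  ext x
  let τ : H ⊗[k] H →ₗ[k] H ⊗[k] H :=
    TensorProduct.map (antipode k) (antipode k) ∘ₗ (TensorProduct.comm k H H).toLinearMap
  let Ψ : H ⊗[k] (H ⊗[k] H) →ₗ[k] H ⊗[k] H :=
    LinearMap.mul' k (H ⊗[k] H) ∘ₗ TensorProduct.map τ comul ∘ₗ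
      (TensorProduct.assoc k H H H).symm.toLinearMap
  have h1 : LinearMap.mul' k (H ⊗[k] H) ∘ₗ TensorProduct.map (τ ∘ₗ comul) comul =
      Ψ ∘ₗ (TensorProduct.assoc k H H H).toLinearMap ∘ₗ LinearMap.rTensor H comul := by
    refine TensorProduct.ext' fun a b => ?_
    simp [Ψ]
  have h2 : Ψ ∘ₗ LinearMap.lTensor H comul =
      TensorProduct.mk k H H 1 ∘ₗ LinearMap.mul' k H ∘ₗ LinearMap.rTensor H (antipode k) := by
    refine TensorProduct.ext' fun a y => ?_
    simp only [LinearMap.comp_apply, LinearMap.lTensor_tmul, LinearMap.rTensor_tmul,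
      LinearMap.mul'_apply, TensorProduct.mk_apply]
    rw [← sum_antipode_tmul_mul_comul]
    generalize comul (R := k) y = w
    induction w with
    | zero => simp
    | add u v hu hv => rw [TensorProduct.tmul_add, map_add, hu, hv, map_add, map_add]
    | tmul c d => simp [Ψ, τ]
  calc _ = LinearMap.mul' k (H ⊗[k] H) (TensorProduct.map (τ ∘ₗ comul) comul
        (comul (R := k) x)) := rfl
    _ = Ψ (TensorProduct.assoc k H H H (LinearMap.rTensor H (comul (R := k)) (comul (R := k) x))) :=
      LinearMap.congr_fun h1 _
    _ = Ψ (LinearMap.lTensor H (comul (R := k)) (comul (R := k) x)) := by rw [coassoc_apply]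
    _ = _ := LinearMap.congr_fun h2 _
    _ = _ := by
      rw [LinearMap.comp_apply, LinearMap.comp_apply, mul_antipode_rTensor_comul_apply,
        LinearMap.convOne_apply, Algebra.algebraMap_eq_smul_one, Algebra.algebraMap_eq_smul_one,
        map_smul, TensorProduct.mk_apply, Algebra.TensorProduct.one_def]

lemma comul_antipode (x : H) :
    comul (R := k) (antipode k x) = TensorProduct.map (antipode k) (antipode k)
      (TensorProduct.comm k H H (comul (R := k) x)) :=
  LinearMap.congr_fun (comul_comp_antipode k H) x

end AntipodeComul

/-! ### The coradical filtration of a pointed Hopf algebra is a Hopf filtration. -/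

section HopfFiltration

variable {k : Type u} {H : Type v} [Field k] [Ring H] [HopfAlgebra k H]

open HopfAlgebra

lemma mem_coradicalFiltration_succ_of_comul {C : Type v} [AddCommGroup C] [Module k C]
    [Coalgebra k C] {n : ℕ} {x : C}
    (h : comul (R := k) x ∈
      LinearMap.range (LinearMap.lTensor C (coradicalFiltration k C n).subtype) ⊔
        LinearMap.range (LinearMap.rTensor C (coradicalFiltration k C 0).subtype)) :
    x ∈ coradicalFiltration k C (n + 1) := h

lemma one_mem_coradicalFiltration : (1 : H) ∈ coradicalFiltration k H 0 :=
  isGroupLikeElem_mem_coradical .one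

lemma mul_mem_of_tensorFiltration {m n : ℕ} {S : Submodule k (H ⊗[k] H)}
    (h : ∀ i j, i + j = m → ∀ i' j', i' + j' = n →
      ∀ a ∈ coradicalFiltration k H i, ∀ b ∈ coradicalFiltration k H j,
      ∀ c ∈ coradicalFiltration k H i', ∀ d ∈ coradicalFiltration k H j',
      (a * c) ⊗ₜ[k] (b * d) ∈ S) {u v : H ⊗[k] H}
    (hu : u ∈ tensorFiltration k H m) (hv : v ∈ tensorFiltration k H n) : u * v ∈ S := by
  refine Submodule.mul_le.1 (?_ : tensorFiltration k H m * tensorFiltration k H n ≤ S) u hu v hv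
  rw [tensorFiltration, tensorFiltration, Submodule.span_mul_span, Submodule.span_le]
  rintro _ ⟨_, ⟨i, j, hij, a, ha, b, hb, rfl⟩, _, ⟨i', j', hij', c, hc, d, hd, rfl⟩, rfl⟩
  simpa only [Algebra.TensorProduct.tmul_mul_tmul, SetLike.mem_coe] using h i j hij i' j' hij' a ha b hb c hc d hd

/-- The coradical filtration of a pointed Hopf algebra is an algebra filtration. -/
theorem IsPointed.mul_mem (hH : IsPointed k H) {m n : ℕ} {x y : H}
    (hx : x ∈ coradicalFiltration k H m) (hy : y ∈ coradicalFiltration k H n) :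
    x * y ∈ coradicalFiltration k H (m + n) := by
  suffices ∀ N m n, m + n = N → ∀ x ∈ coradicalFiltration k H m,
      ∀ y ∈ coradicalFiltration k H n, x * y ∈ coradicalFiltration k H N from
    this _ m n rfl x hx y hy
  intro N
  induction N using Nat.strong_induction_on with
  | _ N ih =>
    intro m n hN x hx y hy
    cases N with
    | zero =>
      obtain ⟨rfl, rfl⟩ : m = 0 ∧ n = 0 := by omega
      refine Submodule.mul_le.1 (?_ : coradical k H * coradical k H ≤ coradical k H) x hx y hy
      rw [hH.coradical_eq_span, Submodule.span_mul_span]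
      refine Submodule.span_mono ?_
      rintro _ ⟨g, hg, h, hh, rfl⟩
      exact IsGroupLikeElem.mul hg hh
    | succ N =>
      refine mem_coradicalFiltration_succ_of_comul ?_
      rw [Bialgebra.comul_mul]
      refine mul_mem_of_tensorFiltration (fun i j hij i' j' hij' a ha b hb c hc d hd => ?_)
        (comul_mem_tensorFiltration hx) (comul_mem_tensorFiltration hy)
      -- If both left factors lie in `H₀`, so does their product; otherwise `j + j' ≤ N` and the
      -- induction hypothesis puts `b * d` in `H_N`.
      by_cases h0 : i = 0 ∧ i' = 0
      · obtain ⟨rfl, rfl⟩ := h0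
        exact Submodule.mem_sup_right
          ⟨⟨a * c, ih 0 N.succ_pos 0 0 rfl a ha c hc⟩ ⊗ₜ[k] (b * d), by simp⟩
      · have hlt : j + j' < N + 1 := by omega
        exact Submodule.mem_sup_left ⟨(a * c) ⊗ₜ[k]
          ⟨b * d, coradicalFiltration_mono (Nat.lt_succ_iff.1 hlt)
            (ih (j + j') hlt j j' rfl b hb d hd)⟩, by simp⟩

/-- The coradical filtration of a pointed Hopf algebra is stable under the antipode. -/
theorem IsPointed.antipode_mem (hH : IsPointed k H) {n : ℕ} {x : H}
    (hx : x ∈ coradicalFiltration k H n) : antipode k x ∈ coradicalFiltration k H n := by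
  induction n using Nat.strong_induction_on generalizing x with
  | _ n ih =>
    cases n with
    | zero =>
      suffices coradical k H ≤ (coradical k H).comap (antipode k) from this hx
      conv_lhs => rw [hH.coradical_eq_span]
      refine Submodule.span_le.2 fun g hg => ?_
      exact isGroupLikeElem_mem_coradical (IsGroupLikeElem.antipode hg)
    | succ n =>
      refine mem_coradicalFiltration_succ_of_comul ?_
      rw [comul_antipode]
      suffices tensorFiltration k H (n + 1) ≤ Submodule.comap
          (TensorProduct.map (antipode k) (antipode k) ∘ₗ
            (TensorProduct.comm k H H).toLinearMap)
          (LinearMap.range (LinearMap.lTensor H (coradicalFiltration k H n).subtype) ⊔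
            LinearMap.range (LinearMap.rTensor H (coradicalFiltration k H 0).subtype)) from
        this (comul_mem_tensorFiltration hx)
      refine Submodule.span_le.2 ?_
      rintro _ ⟨i, j, hij, a, ha, b, hb, rfl⟩
      rw [SetLike.mem_coe, Submodule.mem_comap, LinearMap.comp_apply, LinearEquiv.coe_coe,
        TensorProduct.comm_tmul, TensorProduct.map_tmul]
      -- The antipode swaps the factors: `j = 0` puts `S(b)` in `H₀`, while `j > 0` forces `i ≤ n`
      -- and puts `S(a)` in `Hₙ`.
      cases j with
      | zero =>
        exact Submodule.mem_sup_right ⟨⟨antipode k b, ih 0 n.succ_pos hb⟩ ⊗ₜ[k] antipode k a,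
          by simp⟩
      | succ j =>
        exact Submodule.mem_sup_left ⟨antipode k b ⊗ₜ[k]
          ⟨antipode k a, coradicalFiltration_mono (by omega) (ih i (by omega) ha)⟩, by simp⟩

end HopfFiltration

/-! ### The Hopf algebra `gr(H)`. -/

section AssociatedGraded

variable (k : Type u) (H : Type v) [Field k] [Ring H] [HopfAlgebra k H]

open HopfAlgebra

/-- A copy of the space `gr(H)` that carries the Hopf algebra structure. -/
def AssocGr : Type v := Gr k H

instance : AddCommGroup (AssocGr k H) := inferInstanceAs (AddCommGroup (Gr k H))

instance : Module k (AssocGr k H) := inferInstanceAs (Module k (Gr k H))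

/-- The identification of `gr(H)` with its copy. -/
def toAssocGr : Gr k H ≃ₗ[k] AssocGr k H := LinearEquiv.refl k (Gr k H)

variable {k H}

/-- The class in degree `n`, in the copy of `gr(H)`. -/
abbrev assocSymbol (n : ℕ) : H →ₗ[k] AssocGr k H := symbol (toAssocGr k H) n

lemma mul_mem_pred_left (hH : IsPointed k H) {m n : ℕ} {x y : H}
    (hx : x ∈ coradicalFiltrationPred k H m) (hy : y ∈ coradicalFiltration k H n) :
    x * y ∈ coradicalFiltrationPred k H (m + n) := by
  cases m with
  | zero => simp [(Submodule.mem_bot k).1 hx]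
  | succ m => exact coradicalFiltration_le_pred (by omega) (hH.mul_mem hx hy)

lemma mul_mem_pred_right (hH : IsPointed k H) {m n : ℕ} {x y : H}
    (hx : x ∈ coradicalFiltration k H m) (hy : y ∈ coradicalFiltrationPred k H n) :
    x * y ∈ coradicalFiltrationPred k H (m + n) := by
  cases n with
  | zero => simp [(Submodule.mem_bot k).1 hy]
  | succ n => exact coradicalFiltration_le_pred (by omega) (hH.mul_mem hx hy)

lemma antipode_mem_pred (hH : IsPointed k H) {n : ℕ} {x : H}
    (hx : x ∈ coradicalFiltrationPred k H n) :
    antipode k x ∈ coradicalFiltrationPred k H n := by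
  cases n with
  | zero => simp [(Submodule.mem_bot k).1 hx]
  | succ n => exact hH.antipode_mem hx

/-- The multiplication of `gr(H)`. -/
def grMul (hH : IsPointed k H) : AssocGr k H →ₗ[k] AssocGr k H →ₗ[k] AssocGr k H :=
  grLift₂ (toAssocGr k H) (fun m n => (LinearMap.mul k H).compr₂ (assocSymbol (m + n)))
    (fun _ _ _ hx _ hy => symbol_of_mem_pred (toAssocGr k H) (mul_mem_pred_left hH hx hy))
    (fun _ _ _ hx _ hy => symbol_of_mem_pred (toAssocGr k H) (mul_mem_pred_right hH hx hy))

lemma grMul_symbol (hH : IsPointed k H) {m n : ℕ} {x y : H}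
    (hx : x ∈ coradicalFiltration k H m) (hy : y ∈ coradicalFiltration k H n) :
    grMul hH (assocSymbol m x) (assocSymbol n y) = assocSymbol (m + n) (x * y) :=
  grLift₂_symbol (toAssocGr k H) _ _ _ hx hy

instance : Coalgebra k (AssocGr k H) := grCoalgebra (toAssocGr k H)

lemma comul_assocSymbol {n : ℕ} {x : H} (hx : x ∈ coradicalFiltration k H n) :
    comul (R := k) (assocSymbol (k := k) n x) =
      tensorSymbol (toAssocGr k H) n (comul (R := k) x) :=
  grComul_symbol _ hx

lemma counit_assocSymbol {n : ℕ} {x : H} (hx : x ∈ coradicalFiltration k H n) :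
    counit (R := k) (assocSymbol (k := k) n x) = if n = 0 then counit (R := k) x else 0 :=
  grCounit_symbol _ hx

variable [hH : Fact (IsPointed k H)]

instance : Ring (AssocGr k H) where
  __ := (inferInstance : AddCommGroup (AssocGr k H))
  mul a b := grMul hH.out a b
  one := assocSymbol 0 1
  left_distrib a b c := map_add (grMul hH.out a) b c
  right_distrib a b c := LinearMap.map_add₂ (grMul hH.out) a b c
  zero_mul a := LinearMap.map_zero₂ (grMul hH.out) a
  mul_zero a := map_zero (grMul hH.out a)
  mul_assoc a b c := by
    change grMul hH.out (grMul hH.out a b) c = grMul hH.out a (grMul hH.out b c)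
    induction a using gr_induction (toAssocGr k H) with
    | zero => simp
    | add a a' h h' => simp only [map_add, LinearMap.add_apply, h, h']
    | symbol m x hx =>
      induction b using gr_induction (toAssocGr k H) with
      | zero => simp
      | add b b' h h' => simp only [map_add, LinearMap.add_apply, h, h']
      | symbol n y hy =>
        induction c using gr_induction (toAssocGr k H) with
        | zero => simp
        | add c c' h h' => simp only [map_add, h, h']
        | symbol l z hz =>
          rw [grMul_symbol _ hx hy, grMul_symbol _ hy hz,
            grMul_symbol _ (hH.out.mul_mem hx hy) hz, grMul_symbol _ hx (hH.out.mul_mem hy hz),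
            mul_assoc, add_assoc]
  one_mul a := by
    change grMul hH.out (assocSymbol 0 1) a = a
    induction a using gr_induction (toAssocGr k H) with
    | zero => simp
    | add a a' h h' => rw [map_add, h, h']
    | symbol n x hx => rw [grMul_symbol _ one_mem_coradicalFiltration hx, one_mul, zero_add]
  mul_one a := by
    change grMul hH.out a (assocSymbol 0 1) = a
    induction a using gr_induction (toAssocGr k H) with
    | zero => simp
    | add a a' h h' => rw [map_add, LinearMap.add_apply, h, h']
    | symbol n x hx => rw [grMul_symbol _ hx one_mem_coradicalFiltration, mul_one, add_zero]

lemma assocSymbol_mul {m n : ℕ} {x y : H}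
    (hx : x ∈ coradicalFiltration k H m) (hy : y ∈ coradicalFiltration k H n) :
    assocSymbol m x * assocSymbol n y = assocSymbol (k := k) (m + n) (x * y) :=
  grMul_symbol hH.out hx hy

lemma assocSymbol_one : assocSymbol (k := k) 0 (1 : H) = 1 := rfl

instance : Algebra k (AssocGr k H) :=
  Algebra.ofModule (fun r a b => LinearMap.map_smul₂ (grMul hH.out) r a b)
    (fun r a b => map_smul (grMul hH.out a) r b)

lemma tensorSymbol_mul {m n : ℕ} {u v : H ⊗[k] H} (hu : u ∈ tensorFiltration k H m)
    (hv : v ∈ tensorFiltration k H n) :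
    tensorSymbol (toAssocGr k H) (m + n) (u * v) =
      tensorSymbol (toAssocGr k H) m u * tensorSymbol (toAssocGr k H) n v := by
  refine eq_on_tensorFiltration
    (f := tensorSymbol (toAssocGr k H) (m + n) ∘ₗ LinearMap.mulRight k v)
    (g := LinearMap.mulRight k (tensorSymbol (toAssocGr k H) n v) ∘ₗ
      tensorSymbol (toAssocGr k H) m) (fun i j hij a ha b hb => ?_) hu
  refine eq_on_tensorFiltration
    (f := tensorSymbol (toAssocGr k H) (m + n) ∘ₗ LinearMap.mulLeft k (a ⊗ₜ[k] b))
    (g := LinearMap.mulLeft k (tensorSymbol (toAssocGr k H) m (a ⊗ₜ[k] b)) ∘ₗ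
      tensorSymbol (toAssocGr k H) n) (fun i' j' hij' c hc d hd => ?_) hv
  simp only [LinearMap.comp_apply, LinearMap.mulLeft_apply, Algebra.TensorProduct.tmul_mul_tmul]
  rw [tensorSymbol_tmul _ hij ha hb, tensorSymbol_tmul _ hij' hc hd,
    tensorSymbol_tmul _ (i := i + i') (j := j + j') (by omega) (hH.out.mul_mem ha hc)
      (hH.out.mul_mem hb hd), Algebra.TensorProduct.tmul_mul_tmul, assocSymbol_mul ha hc,
    assocSymbol_mul hb hd]

instance : Bialgebra k (AssocGr k H) :=
  Bialgebra.mk' k (AssocGr k H)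
    (by
      rw [← assocSymbol_one]
      exact (counit_assocSymbol one_mem_coradicalFiltration).trans (by simp))
    (by
      intro a b
      induction a using gr_induction (toAssocGr k H) with
      | zero => simp
      | add a a' h h' => rw [add_mul, map_add, map_add, add_mul, h, h']
      | symbol m x hx =>
        induction b using gr_induction (toAssocGr k H) with
        | zero => simp
        | add b b' h h' => rw [mul_add, map_add, map_add, mul_add, h, h']
        | symbol n y hy =>
          rw [assocSymbol_mul hx hy, counit_assocSymbol hx, counit_assocSymbol hy,
            counit_assocSymbol (hH.out.mul_mem hx hy)]
          by_cases hm : m = 0 <;> by_cases hn : n = 0 <;> simp [hm, hn])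
    (by
      rw [← assocSymbol_one]
      refine (comul_assocSymbol one_mem_coradicalFiltration).trans ?_
      rw [Bialgebra.comul_one, Algebra.TensorProduct.one_def, Algebra.TensorProduct.one_def,
        tensorSymbol_tmul _ (add_zero 0) one_mem_coradicalFiltration one_mem_coradicalFiltration,
        ← assocSymbol_one])
    (by
      intro a b
      induction a using gr_induction (toAssocGr k H) with
      | zero => simp
      | add a a' h h' => rw [add_mul, map_add, map_add, add_mul, h, h']
      | symbol m x hx =>
        induction b using gr_induction (toAssocGr k H) with
        | zero => simp
        | add b b' h h' => rw [mul_add, map_add, map_add, mul_add, h, h']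
        | symbol n y hy =>
          rw [assocSymbol_mul hx hy, comul_assocSymbol hx, comul_assocSymbol hy,
            comul_assocSymbol (hH.out.mul_mem hx hy), Bialgebra.comul_mul]
          exact tensorSymbol_mul (comul_mem_tensorFiltration hx) (comul_mem_tensorFiltration hy))

/-- The antipode of `gr(H)`. -/
def grAntipode : AssocGr k H →ₗ[k] AssocGr k H :=
  grLift (toAssocGr k H) (fun n => assocSymbol n ∘ₗ antipode k)
    (fun _ _ hx => symbol_of_mem_pred (toAssocGr k H) (antipode_mem_pred hH.out hx))

lemma grAntipode_symbol {n : ℕ} {x : H} (hx : x ∈ coradicalFiltration k H n) :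
    grAntipode (assocSymbol n x) = assocSymbol (k := k) n (antipode k x) :=
  grLift_symbol (toAssocGr k H) _ _ hx

/-- For `n > 0` both sides vanish: scalars lie in `H₀`, and the counit of `gr(H)` is zero in degree
`n`. -/
lemma assocSymbol_algebraMap (n : ℕ) {x : H} (hx : x ∈ coradicalFiltration k H n) :
    assocSymbol n (algebraMap k H (counit (R := k) x)) =
      algebraMap k (AssocGr k H) (counit (R := k) (assocSymbol (k := k) n x)) := by
  rw [counit_assocSymbol hx, Algebra.algebraMap_eq_smul_one, Algebra.algebraMap_eq_smul_one,
    map_smul]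
  split_ifs with h
  · rw [h, assocSymbol_one]
  · rw [symbol_of_lt _ (Nat.pos_of_ne_zero h) one_mem_coradicalFiltration, smul_zero, zero_smul]

/-- Used with `S` and the identity, in both orders, to transfer the two antipode axioms. -/
lemma mul_tensorSymbol {n : ℕ} {f g : H →ₗ[k] H} {F G : AssocGr k H →ₗ[k] AssocGr k H}
    (hf : ∀ m, ∀ x ∈ coradicalFiltration k H m, f x ∈ coradicalFiltration k H m ∧
      F (assocSymbol m x) = assocSymbol m (f x))
    (hg : ∀ m, ∀ x ∈ coradicalFiltration k H m, g x ∈ coradicalFiltration k H m ∧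
      G (assocSymbol m x) = assocSymbol m (g x))
    {u : H ⊗[k] H} (hu : u ∈ tensorFiltration k H n) :
    LinearMap.mul' k (AssocGr k H)
        (TensorProduct.map F G (tensorSymbol (toAssocGr k H) n u)) =
      assocSymbol n (LinearMap.mul' k H (TensorProduct.map f g u)) := by
  refine eq_on_tensorFiltration
    (f := LinearMap.mul' k (AssocGr k H) ∘ₗ TensorProduct.map F G ∘ₗ
      tensorSymbol (toAssocGr k H) n)
    (g := assocSymbol n ∘ₗ LinearMap.mul' k H ∘ₗ TensorProduct.map f g)
    (fun i j hij x hx y hy => ?_) hu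
  simp only [LinearMap.comp_apply, TensorProduct.map_tmul, LinearMap.mul'_apply]
  rw [tensorSymbol_tmul _ hij hx hy, TensorProduct.map_tmul, LinearMap.mul'_apply,
    (hf i x hx).2, (hg j y hy).2, assocSymbol_mul (hf i x hx).1 (hg j y hy).1, hij]

instance : HopfAlgebra k (AssocGr k H) where
  antipode := grAntipode
  mul_antipode_rTensor_comul := gr_hom_ext (toAssocGr k H) fun n x hx => by
    simp only [LinearMap.comp_apply, Algebra.linearMap_apply]
    rw [← assocSymbol_algebraMap n hx, ← mul_antipode_rTensor_comul_apply (R := k) x,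
      comul_assocSymbol hx]
    exact mul_tensorSymbol (fun m x hx => ⟨hH.out.antipode_mem hx, grAntipode_symbol hx⟩)
      (fun m x hx => ⟨hx, rfl⟩) (comul_mem_tensorFiltration hx)
  mul_antipode_lTensor_comul := gr_hom_ext (toAssocGr k H) fun n x hx => by
    simp only [LinearMap.comp_apply, Algebra.linearMap_apply]
    rw [← assocSymbol_algebraMap n hx, ← mul_antipode_lTensor_comul_apply (R := k) x,
      comul_assocSymbol hx]
    exact mul_tensorSymbol (fun m x hx => ⟨hx, rfl⟩)
      (fun m x hx => ⟨hH.out.antipode_mem hx, grAntipode_symbol hx⟩)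
      (comul_mem_tensorFiltration hx)

end AssociatedGraded

/-- The degeneration of a pointed Hopf algebra exists. -/
theorem nonempty_degeneration {k : Type u} {H : Type v} [Field k] [Ring H] [HopfAlgebra k H]
    (hH : IsPointed k H) : Nonempty (Degeneration k H) := by
  have : Fact (IsPointed k H) := ⟨hH⟩
  exact ⟨{
    carrier := AssocGr k H
    equiv := toAssocGr k H
    one_eq := ⟨one_mem_coradicalFiltration, (symbol_coe (toAssocGr k H) 0 _).symm⟩
    mul_eq := fun m n x y => by
      refine ⟨hH.mul_mem x.2 y.2, ?_⟩
      rw [← symbol_coe, ← symbol_coe, ← symbol_coe]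
      exact assocSymbol_mul x.2 y.2
    counit_eq := fun n x => by
      rw [← symbol_coe]
      exact counit_assocSymbol x.2
    comul_eq := fun n x => by
      obtain ⟨w, hw⟩ := exists_eq_sum_of_mem_tensorFiltration (comul_mem_tensorFiltration x.2)
      refine ⟨w, hw, ?_⟩
      rw [← symbol_coe, ← tensorSymbol_sum, ← hw]
      exact comul_assocSymbol x.2
    antipode_eq := fun n x => by
      refine ⟨hH.antipode_mem x.2, ?_⟩
      rw [← symbol_coe, ← symbol_coe]
      exact grAntipode_symbol x.2 }⟩

/-! ### Pointedness of `gr(C)`. -/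

section PointedGraded

variable {k : Type u} {C : Type v} [Field k] [AddCommGroup C] [Module k C] [Coalgebra k C]

/-- A nonzero element of a subcoalgebra `D` that is a combination of group-like elements exhibits
a group-like element in `D`. -/
lemma IsSubcoalgebra.exists_groupLike {D : Submodule k C} (hD : IsSubcoalgebra k D) {y : C}
    (hy : y ∈ D) (hy0 : y ≠ 0) (hspan : y ∈ Submodule.span k {g : C | IsGroupLikeElem k g}) :
    ∃ g ∈ D, IsGroupLikeElem k g := by
  have hrange : {g : C | IsGroupLikeElem k g} =
      Set.range (GroupLike.val : GroupLike k C → C) :=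
    Set.ext fun g => ⟨fun hg => ⟨⟨g, hg⟩, rfl⟩, fun ⟨h, hh⟩ => hh ▸ h.isGroupLikeElem_val⟩
  have li : LinearIndependent k (GroupLike.val : GroupLike k C → C) := linearIndep_groupLikeVal
  rw [hrange, Finsupp.mem_span_range_iff_exists_finsupp] at hspan
  obtain ⟨c, rfl⟩ := hspan
  obtain ⟨g, hg⟩ : ∃ g, c g ≠ 0 := by
    by_contra! h
    exact hy0 (by simp [Finsupp.sum, h])
  -- Group-likes are linearly independent, so some functional is `1` on `g` and `0` on all others;
  -- slicing by it isolates the term `c g • g` inside `D`.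
  obtain ⟨f, hf⟩ := LinearMap.exists_extend (Finsupp.lapply g ∘ₗ li.repr)
  have hfval : ∀ h : GroupLike k C, f h.val = Finsupp.single h (1 : k) g := by
    intro h
    have hmem : h.val ∈ Submodule.span k (Set.range (GroupLike.val : GroupLike k C → C)) :=
      Submodule.subset_span ⟨h, rfl⟩
    have := LinearMap.congr_fun hf ⟨h.val, hmem⟩
    rw [LinearMap.comp_apply, LinearMap.comp_apply,
      li.repr_eq_single h _ rfl] at this
    exact this
  have hslice : ∀ h : GroupLike k C,
      leftSlice f h.val = Finsupp.single h (1 : k) g • h.val := by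
    intro h
    simp [leftSlice, h.isGroupLikeElem_val.comul_eq_tmul_self, hfval]
  have hmem := hD.leftSlice_mem f hy
  have hval : leftSlice f (c.sum fun i a => a • i.val) = c g • g.val := by
    rw [Finsupp.sum, map_sum, Finset.sum_eq_single g]
    · rw [map_smul, hslice, Finsupp.single_eq_same, one_smul]
    · intro h _ hne
      rw [map_smul, hslice, Finsupp.single_eq_of_ne hne.symm, zero_smul, smul_zero]
    · intro hgs
      simp [Finsupp.notMem_support_iff.1 hgs]
  rw [hval] at hmem
  exact ⟨g.val, (Submodule.smul_mem_iff D hg).1 hmem, g.isGroupLikeElem_val⟩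

variable {A : Type*} [AddCommGroup A] [Module k A] (E : Gr k C ≃ₗ[k] A)

/-- The part of `gr(C)` of degree less than `N`. -/
def grBelow (N : ℕ) : Submodule k A :=
  Submodule.span k {a | ∃ n < N, ∃ x ∈ coradicalFiltration k C n, a = symbol E n x}

lemma exists_mem_grBelow (a : A) : ∃ N, a ∈ grBelow E N := by
  have mono : ∀ {M N}, M ≤ N → grBelow E M ≤ grBelow E N := fun h =>
    Submodule.span_mono fun _ ⟨n, hn, w⟩ => ⟨n, hn.trans_le h, w⟩
  induction a using gr_induction E with
  | zero => exact ⟨0, zero_mem _⟩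
  | add a b ha hb =>
    obtain ⟨M, hM⟩ := ha
    obtain ⟨N, hN⟩ := hb
    exact ⟨max M N, add_mem (mono (le_max_left _ _) hM) (mono (le_max_right _ _) hN)⟩
  | symbol n x hx => exact ⟨n + 1, Submodule.subset_span ⟨n, n.lt_succ_self, x, hx, rfl⟩⟩

variable {E} [Coalgebra k A]

/-- In `f(a₁) a₂` the factor `a₁` counts only in degrees at least `N`, while the total degree is at
most `N`; hence `a₂` has degree zero. -/
lemma leftSlice_mem_degree_zero
    (hcomul : ∀ n, ∀ x ∈ coradicalFiltration k C n,
      comul (R := k) (symbol E n x) = tensorSymbol E n (comul (R := k) x))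
    {N : ℕ} {f : A →ₗ[k] k} (hf : ∀ a ∈ grBelow E N, f a = 0) {a : A}
    (ha : a ∈ grBelow E (N + 1)) :
    leftSlice f a ∈ (coradical k C).map (symbol E 0) := by
  suffices grBelow E (N + 1) ≤ ((coradical k C).map (symbol E 0)).comap (leftSlice f) from this ha
  refine Submodule.span_le.2 ?_
  rintro _ ⟨n, hn, x, hx, rfl⟩
  rw [SetLike.mem_coe, Submodule.mem_comap, leftSlice, LinearMap.comp_apply, LinearMap.comp_apply,
    hcomul n x hx]
  suffices tensorFiltration k C n ≤ ((coradical k C).map (symbol E 0)).comap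
      ((TensorProduct.lid k A).toLinearMap ∘ₗ LinearMap.rTensor A f ∘ₗ tensorSymbol E n) from
    this (comul_mem_tensorFiltration hx)
  refine Submodule.span_le.2 ?_
  rintro _ ⟨i, j, hij, y, hy, z, hz, rfl⟩
  rw [SetLike.mem_coe, Submodule.mem_comap, LinearMap.comp_apply, LinearMap.comp_apply,
    tensorSymbol_tmul E hij hy hz, LinearMap.rTensor_tmul, LinearEquiv.coe_coe,
    TensorProduct.lid_tmul]
  by_cases hi : i < N
  · rw [hf _ (Submodule.subset_span ⟨i, hi, y, hy, rfl⟩), zero_smul]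
    exact zero_mem _
  · obtain rfl : j = 0 := by omega
    exact Submodule.smul_mem _ _ ⟨z, hz, rfl⟩

/-- If `C` is pointed, then so is `gr(C)`. -/
theorem isPointed_of_symbol (hC : IsPointed k C)
    (hcomul : ∀ n, ∀ x ∈ coradicalFiltration k C n,
      comul (R := k) (symbol E n x) = tensorSymbol E n (comul (R := k) x))
    (hcounit : ∀ x ∈ coradicalFiltration k C 0,
      counit (R := k) (symbol E 0 x) = counit (R := k) x) : IsPointed k A := by
  intro D hD
  obtain ⟨x, hxD, hx0⟩ := D.ne_bot_iff.1 hD.2.1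
  obtain ⟨y, hyD, hy0, hy⟩ : ∃ y ∈ D, y ≠ 0 ∧ y ∈ (coradical k C).map (symbol E 0) := by
    classical
    have hex := exists_mem_grBelow E x
    -- `N` is the top degree of `x`; the least bound is not `0` because `grBelow E 0` is zero and
    -- `x` is not.
    obtain ⟨N, hN⟩ : ∃ N, Nat.find hex = N + 1 := by
      refine Nat.exists_eq_succ_of_ne_zero fun h => hx0 ?_
      have := Nat.find_spec hex
      rw [h] at this
      simpa [grBelow] using this
    have hmem : x ∈ grBelow E (N + 1) := hN ▸ Nat.find_spec hex
    have hnot : x ∉ grBelow E N := Nat.find_min hex (by omega)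
    obtain ⟨f, hfx, hf⟩ := Submodule.exists_le_ker_of_notMem hnot
    refine ⟨leftSlice f x, hD.1.leftSlice_mem f hxD, fun h => hfx ?_,
      leftSlice_mem_degree_zero hcomul (fun a ha => hf ha) hmem⟩
    -- The slice is nonzero because its counit is `f x ≠ 0`.
    rw [← counit_leftSlice f x, h, map_zero]
  have hspan : (coradical k C).map (symbol E 0) ≤
      Submodule.span k {g : A | IsGroupLikeElem k g} := by
    rw [hC.coradical_eq_span, Submodule.map_span, Submodule.span_le]
    rintro _ ⟨g, hg, rfl⟩
    have hg0 : g ∈ coradicalFiltration k C 0 := isGroupLikeElem_mem_coradical hg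
    refine Submodule.subset_span ⟨?_, ?_⟩
    · rw [hcounit g hg0, hg.counit_eq_one]
    · rw [hcomul 0 g hg0, hg.comul_eq_tmul_self, tensorSymbol_tmul E (add_zero 0) hg0 hg0]
  obtain ⟨g, hgD, hg⟩ := hD.1.exists_groupLike hyD hy0 (hspan hy)
  have hle : (k ∙ g) ≤ D := (Submodule.span_singleton_le_iff_mem g D).2 hgD
  rcases hD.2.2 _ (isSubcoalgebra_span_singleton hg) hle with h | h
  · exact absurd (Submodule.span_singleton_eq_bot.1 h) hg.ne_zero
  · rw [← h]
    exact finrank_span_singleton hg.ne_zero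

end PointedGraded

/-! ### The form `gr(𝓡)` on an arbitrary degeneration. -/

section Form

variable {k : Type u} {H : Type v} [Field k] [Ring H] [HopfAlgebra k H] (D : Degeneration k H)

namespace Degeneration

lemma symbol_mul {m n : ℕ} {x y : H} (hx : x ∈ coradicalFiltration k H m)
    (hy : y ∈ coradicalFiltration k H n) :
    symbol D.equiv m x * symbol D.equiv n y = symbol D.equiv (m + n) (x * y) := by
  obtain ⟨h, e⟩ := D.mul_eq m n ⟨x, hx⟩ ⟨y, hy⟩
  rw [← symbol_coe, ← symbol_coe, ← symbol_coe] at e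
  exact e

lemma mul_mem (D : Degeneration k H) {m n : ℕ} {x y : H} (hx : x ∈ coradicalFiltration k H m)
    (hy : y ∈ coradicalFiltration k H n) : x * y ∈ coradicalFiltration k H (m + n) := by
  obtain ⟨h, _⟩ := D.mul_eq m n ⟨x, hx⟩ ⟨y, hy⟩
  exact h

lemma counit_symbol {n : ℕ} {x : H} (hx : x ∈ coradicalFiltration k H n) :
    counit (R := k) (symbol D.equiv n x) = if n = 0 then counit (R := k) x else 0 := by
  have e := D.counit_eq n ⟨x, hx⟩
  rwa [← symbol_coe] at e

lemma comul_symbol {n : ℕ} {x : H} (hx : x ∈ coradicalFiltration k H n) :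
    comul (R := k) (symbol D.equiv n x) = tensorSymbol D.equiv n (comul (R := k) x) := by
  obtain ⟨w, h1, h2⟩ := D.comul_eq n ⟨x, hx⟩
  rw [← symbol_coe, ← tensorSymbol_sum, ← h1] at h2
  exact h2

/-- The projection of `gr(H)` onto its component `H₀` of degree zero. -/
def proj : D.carrier →ₗ[k] H := grDegreeZero k H ∘ₗ D.equiv.symm.toLinearMap

lemma proj_symbol {n : ℕ} {x : H} (hx : x ∈ coradicalFiltration k H n) :
    D.proj (symbol D.equiv n x) = if n = 0 then x else 0 := by
  rw [symbol_coe D.equiv n ⟨x, hx⟩, proj, LinearMap.comp_apply, LinearEquiv.coe_coe,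
    LinearEquiv.symm_apply_apply, grDegreeZero, grClass, LinearMap.comp_apply,
    LinearMap.comp_apply]
  cases n with
  | zero => erw [DirectSum.component.lof_self]; rfl
  | succ n =>
    rw [DirectSum.component.of, dif_neg (by omega), map_zero, if_neg (by omega)]

lemma proj_mul (a b : D.carrier) : D.proj (a * b) = D.proj a * D.proj b := by
  induction a using gr_induction D.equiv with
  | zero => simp
  | add a a' h h' => rw [add_mul, map_add, map_add, add_mul, h, h']
  | symbol m x hx =>
    induction b using gr_induction D.equiv with
    | zero => simp
    | add b b' h h' => rw [mul_add, map_add, map_add, mul_add, h, h']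
    | symbol n y hy =>
      rw [D.symbol_mul hx hy, D.proj_symbol hx, D.proj_symbol hy, D.proj_symbol (D.mul_mem hx hy)]
      by_cases hm : m = 0 <;> by_cases hn : n = 0 <;> simp [hm, hn]

/-- Only bidegree `(0, 0)` survives the projection, and it occurs only for `n = 0`; this is what
makes `proj` comultiplicative. -/
lemma map_proj_tensorSymbol {n : ℕ} {u : H ⊗[k] H} (hu : u ∈ tensorFiltration k H n) :
    TensorProduct.map D.proj D.proj (tensorSymbol D.equiv n u) = if n = 0 then u else 0 := by
  have := eq_on_tensorFiltration
    (f := TensorProduct.map D.proj D.proj ∘ₗ tensorSymbol D.equiv n)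
    (g := if n = 0 then LinearMap.id else 0) (fun i j hij x hx y hy => ?_) hu
  · rw [← LinearMap.comp_apply, this]
    split_ifs <;> rfl
  · rw [LinearMap.comp_apply, tensorSymbol_tmul _ hij hx hy, TensorProduct.map_tmul,
      D.proj_symbol hx, D.proj_symbol hy]
    split_ifs <;> first | omega | simp

/-- The projection onto the component of degree zero as a map of coalgebras. -/
def projCoalgHom : D.carrier →ₗc[k] H where
  __ := D.proj
  counit_comp := gr_hom_ext D.equiv fun n x hx => by
    change counit (D.proj (symbol D.equiv n x)) = _
    rw [D.proj_symbol hx, D.counit_symbol hx]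
    split_ifs <;> simp
  map_comp_comul := gr_hom_ext D.equiv fun n x hx => by
    change TensorProduct.map D.proj D.proj (comul (symbol D.equiv n x)) =
      comul (D.proj (symbol D.equiv n x))
    rw [D.comul_symbol hx, D.map_proj_tensorSymbol (comul_mem_tensorFiltration hx),
      D.proj_symbol hx]
    split_ifs <;> simp

lemma comul_proj (a : D.carrier) :
    comul (R := k) (D.proj a) = TensorProduct.map D.proj D.proj (comul (R := k) a) :=
  (CoalgHomClass.map_comp_comul_apply D.projCoalgHom a).symm

lemma form_eq (R : H ⊗[k] H →ₗ[k] k) :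
    D.form R = R ∘ₗ TensorProduct.map D.proj D.proj := by
  rw [form, grForm, LinearMap.comp_assoc, ← TensorProduct.map_comp]
  rfl

lemma form_tmul (R : H ⊗[k] H →ₗ[k] k) (a b : D.carrier) :
    D.form R (a ⊗ₜ[k] b) = R (D.proj a ⊗ₜ[k] D.proj b) := by
  rw [form_eq, LinearMap.comp_apply, TensorProduct.map_tmul]

/-- Pullback along a coalgebra map preserves convolution products and the convolution unit. -/
lemma form_mul_form {R R' : H ⊗[k] H →ₗ[k] k} (h : toConv R * toConv R' = 1) :
    toConv (D.form R) * toConv (D.form R') = 1 := by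
  let P : D.carrier ⊗[k] D.carrier →ₗc[k] H ⊗[k] H :=
    Coalgebra.TensorProduct.map D.projCoalgHom D.projCoalgHom
  have hP : ∀ S : H ⊗[k] H →ₗ[k] k, D.form S = S ∘ₗ P.toLinearMap := fun S => D.form_eq S
  have := LinearMap.convMul_comp_coalgHom_distrib (toConv R) (toConv R') P
  rw [h] at this
  rw [hP, hP]
  refine ofConv_injective (this.symm.trans ?_)
  refine LinearMap.ext fun x => ?_
  exact congrArg (algebraMap k k) (CoalgHomClass.counit_comp_apply P x)

lemma isUnit_form {R : H ⊗[k] H →ₗ[k] k} (h : IsUnit (toConv R)) : IsUnit (toConv (D.form R)) := by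
  obtain ⟨⟨_, s, hrs, hsr⟩, rfl⟩ := h
  exact ⟨⟨_, _, D.form_mul_form (R := R) (R' := s.ofConv) hrs,
    D.form_mul_form (R := s.ofConv) (R' := R) hsr⟩, rfl⟩

lemma form_mul_left {R : H ⊗[k] H →ₗ[k] k} (hR : IsCoquasitriangular k H R) (a b c : D.carrier) :
    D.form R ((a * b) ⊗ₜ[k] c) = LinearMap.mul' k k
      (TensorProduct.map (TensorProduct.curry (D.form R) a) (TensorProduct.curry (D.form R) b)
        (comul c)) := by
  have h : ∀ a, TensorProduct.curry (D.form R) a = TensorProduct.curry R (D.proj a) ∘ₗ D.proj :=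
    fun a => LinearMap.ext fun b => D.form_tmul R a b
  rw [form_tmul, proj_mul, hR.mul_left, comul_proj, h, h, TensorProduct.map_comp,
    LinearMap.comp_apply]

lemma form_mul_right {R : H ⊗[k] H →ₗ[k] k} (hR : IsCoquasitriangular k H R) (a b c : D.carrier) :
    D.form R (a ⊗ₜ[k] (b * c)) = LinearMap.mul' k k
      (TensorProduct.map ((TensorProduct.curry (D.form R)).flip c)
        ((TensorProduct.curry (D.form R)).flip b) (comul a)) := by
  have h : ∀ a, (TensorProduct.curry (D.form R)).flip a =
      (TensorProduct.curry R).flip (D.proj a) ∘ₗ D.proj :=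
    fun a => LinearMap.ext fun b => D.form_tmul R b a
  rw [form_tmul, proj_mul, hR.mul_right, comul_proj, h, h, TensorProduct.map_comp,
    LinearMap.comp_apply]

/-- Two linear maps on `(H ⊗ H) ⊗ (H ⊗ H)` agree on `Tₘ ⊗ Tₙ`, where `Tₘ = ∑ Hᵢ ⊗ Hⱼ`, `i + j = m`,
if they agree on its pure tensors. -/
lemma eq_on_tensorFiltration_tmul {C W : Type*} [AddCommGroup C] [Module k C] [Coalgebra k C]
    [AddCommGroup W] [Module k W] {m n : ℕ} {f g : C ⊗[k] C →ₗ[k] C ⊗[k] C →ₗ[k] W}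
    (h : ∀ i j, i + j = m → ∀ i' j', i' + j' = n →
      ∀ a ∈ coradicalFiltration k C i, ∀ c ∈ coradicalFiltration k C j,
      ∀ b ∈ coradicalFiltration k C i', ∀ d ∈ coradicalFiltration k C j',
      f (a ⊗ₜ[k] c) (b ⊗ₜ[k] d) = g (a ⊗ₜ[k] c) (b ⊗ₜ[k] d))
    {u v : C ⊗[k] C} (hu : u ∈ tensorFiltration k C m) (hv : v ∈ tensorFiltration k C n) :
    f u v = g u v := by
  refine eq_on_tensorFiltration (f := f.flip v) (g := g.flip v) (fun i j hij a ha c hc => ?_) hu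
  exact eq_on_tensorFiltration (f := f (a ⊗ₜ[k] c)) (g := g (a ⊗ₜ[k] c))
    (fun i' j' hij' b hb d hd => h i j hij i' j' hij' a ha c hc b hb d hd) hv

/-- The convolution product of `F` and `G` evaluated on `x ⊗ y`, as a bilinear map in `Δ(x)` and
`Δ(y)`. -/
def convBilin {C B : Type*} [AddCommGroup C] [Module k C] [Ring B] [Algebra k B]
    (F G : C ⊗[k] C →ₗ[k] B) : C ⊗[k] C →ₗ[k] C ⊗[k] C →ₗ[k] B :=
  TensorProduct.curry (LinearMap.mul' k B ∘ₗ TensorProduct.map F G ∘ₗ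
    (TensorProduct.AlgebraTensorModule.tensorTensorTensorComm k k k k C C C C).toLinearMap)

lemma convBilin_tmul {C B : Type*} [AddCommGroup C] [Module k C] [Ring B] [Algebra k B]
    (F G : C ⊗[k] C →ₗ[k] B) (a b c d : C) :
    convBilin F G (a ⊗ₜ[k] c) (b ⊗ₜ[k] d) = F (a ⊗ₜ[k] b) * G (c ⊗ₜ[k] d) := by
  simp [convBilin]

lemma convMul_tmul {C B : Type*} [AddCommGroup C] [Module k C] [Coalgebra k C] [Ring B]
    [Algebra k B] (F G : C ⊗[k] C →ₗ[k] B) (a b : C) :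
    (toConv F * toConv G) (a ⊗ₜ[k] b) = convBilin F G (comul (R := k) a) (comul (R := k) b) :=
  rfl

/-- On pure tensors compare `b a 𝓡(c, d)` on the two sides. Unless `c` and `d` both have index zero,
`gr(𝓡)` vanishes on the left, and on the right `b a` lies below degree `m + n`, so its symbol
vanishes. -/
lemma convBilin_left {R : H ⊗[k] H →ₗ[k] k} {m n : ℕ} {u v : H ⊗[k] H}
    (hu : u ∈ tensorFiltration k H m) (hv : v ∈ tensorFiltration k H n) :
    convBilin (LinearMap.mul' k D.carrier ∘ₗ (TensorProduct.comm k _ _).toLinearMap)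
        (Algebra.linearMap k D.carrier ∘ₗ D.form R) (tensorSymbol D.equiv m u)
        (tensorSymbol D.equiv n v) =
      symbol D.equiv (m + n) (convBilin
        (LinearMap.mul' k H ∘ₗ (TensorProduct.comm k H H).toLinearMap)
        (Algebra.linearMap k H ∘ₗ R) u v) := by
  refine eq_on_tensorFiltration_tmul
    (f := (convBilin _ _).compl₁₂ (tensorSymbol D.equiv m) (tensorSymbol D.equiv n))
    (g := (convBilin _ _).compr₂ (symbol D.equiv (m + n)))
    (fun i j hij i' j' hij' a ha c hc b hb d hd => ?_) hu hv
  rw [LinearMap.compl₁₂_apply, LinearMap.compr₂_apply, tensorSymbol_tmul _ hij ha hc,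
    tensorSymbol_tmul _ hij' hb hd, convBilin_tmul, convBilin_tmul]
  simp only [LinearMap.comp_apply, LinearEquiv.coe_coe, TensorProduct.comm_tmul,
    LinearMap.mul'_apply, Algebra.linearMap_apply]
  rw [form_tmul, D.symbol_mul hb ha, D.proj_symbol hc, D.proj_symbol hd,
    Algebra.algebraMap_eq_smul_one, Algebra.algebraMap_eq_smul_one, mul_smul_comm, mul_one,
    mul_smul_comm, mul_one, map_smul]
  by_cases h0 : j = 0 ∧ j' = 0
  · rw [if_pos h0.1, if_pos h0.2, show i' + i = m + n by omega]
  · rw [symbol_of_lt D.equiv (show i' + i < m + n by omega) (D.mul_mem hb ha), smul_zero]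
    by_cases hj : j = 0
    · rw [if_neg (show j' ≠ 0 from fun h => h0 ⟨hj, h⟩), TensorProduct.tmul_zero, map_zero,
        zero_smul]
    · rw [if_neg hj, TensorProduct.zero_tmul, map_zero, zero_smul]

lemma convBilin_right {R : H ⊗[k] H →ₗ[k] k} {m n : ℕ} {u v : H ⊗[k] H}
    (hu : u ∈ tensorFiltration k H m) (hv : v ∈ tensorFiltration k H n) :
    convBilin (Algebra.linearMap k D.carrier ∘ₗ D.form R) (LinearMap.mul' k D.carrier)
        (tensorSymbol D.equiv m u) (tensorSymbol D.equiv n v) =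
      symbol D.equiv (m + n) (convBilin
        (Algebra.linearMap k H ∘ₗ R) (LinearMap.mul' k H) u v) := by
  refine eq_on_tensorFiltration_tmul
    (f := (convBilin _ _).compl₁₂ (tensorSymbol D.equiv m) (tensorSymbol D.equiv n))
    (g := (convBilin _ _).compr₂ (symbol D.equiv (m + n)))
    (fun i j hij i' j' hij' a ha c hc b hb d hd => ?_) hu hv
  rw [LinearMap.compl₁₂_apply, LinearMap.compr₂_apply, tensorSymbol_tmul _ hij ha hc,
    tensorSymbol_tmul _ hij' hb hd, convBilin_tmul, convBilin_tmul]
  simp only [LinearMap.comp_apply, LinearMap.mul'_apply, Algebra.linearMap_apply]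
  rw [form_tmul, D.symbol_mul hc hd, D.proj_symbol ha, D.proj_symbol hb,
    Algebra.algebraMap_eq_smul_one, Algebra.algebraMap_eq_smul_one, smul_mul_assoc, one_mul,
    smul_mul_assoc, one_mul, map_smul]
  by_cases h0 : i = 0 ∧ i' = 0
  · rw [if_pos h0.1, if_pos h0.2, show j + j' = m + n by omega]
  · rw [symbol_of_lt D.equiv (show j + j' < m + n by omega) (D.mul_mem hc hd), smul_zero]
    by_cases hi : i = 0
    · rw [if_neg (show i' ≠ 0 from fun h => h0 ⟨hi, h⟩), TensorProduct.tmul_zero, map_zero,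
        zero_smul]
    · rw [if_neg hi, TensorProduct.zero_tmul, map_zero, zero_smul]

/-- The form `gr(𝓡)` makes `gr(H)` a coquasitriangular Hopf algebra. -/
theorem isCoquasitriangular_form {R : H ⊗[k] H →ₗ[k] k} (hR : IsCoquasitriangular k H R) :
    IsCoquasitriangular k D.carrier (D.form R) where
  convolution_invertible := D.isUnit_form hR.convolution_invertible
  mul_left := D.form_mul_left hR
  mul_right := D.form_mul_right hR
  comm := by
    -- On classes of `x ∈ Hₘ` and `y ∈ Hₙ`, each side is the degree `m + n` symbol of the
    -- corresponding side in `H`, where `hR.comm` applies.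
    refine ofConv_injective (TensorProduct.ext (gr_hom_ext D.equiv fun m x hx =>
      gr_hom_ext D.equiv fun n y hy => ?_))
    refine (convMul_tmul _ _ _ _).trans (Eq.trans ?_ (convMul_tmul _ _ _ _).symm)
    rw [D.comul_symbol hx, D.comul_symbol hy,
      D.convBilin_left (comul_mem_tensorFiltration hx) (comul_mem_tensorFiltration hy),
      D.convBilin_right (comul_mem_tensorFiltration hx) (comul_mem_tensorFiltration hy),
      ← convMul_tmul, ← convMul_tmul, hR.comm]

/-- The degeneration of a pointed Hopf algebra is pointed. -/
theorem isPointed (hH : IsPointed k H) : IsPointed k D.carrier :=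
  isPointed_of_symbol (E := D.equiv) hH (fun _ _ hx => D.comul_symbol hx)
    (fun _ hx => (D.counit_symbol hx).trans (if_pos rfl))

end Degeneration

end Form

end CoquasiDegeneration

end

theorem lemma4p1 {k : Type u} {H : Type v} [Field k] [Ring H] [HopfAlgebra k H]
    (hH : CoquasiDegeneration.IsPointed k H)
    (R : H ⊗[k] H →ₗ[k] k) (hR : CoquasiDegeneration.IsCoquasitriangular k H R) :
    Nonempty (CoquasiDegeneration.Degeneration k H) ∧
      ∀ D : CoquasiDegeneration.Degeneration k H,
        CoquasiDegeneration.IsCoquasitriangular k D.carrier (D.form R) ∧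
          CoquasiDegeneration.IsPointed k D.carrier :=
  ⟨CoquasiDegeneration.nonempty_degeneration hH,
    fun D => ⟨D.isCoquasitriangular_form hR, D.isPointed hH⟩⟩
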